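/- Let $\mathbb T$ be the unit circle with normalized Lebesgue measure, $P_+$ the orthogonal projection of $L^2(\mathbb T)$ onto the Hardy space $H^2$, and $P_-=I-P_+$. For $H=\begin{pmatrix} f&\phi\\ g&\psi\end{pmatrix}$ with entries in $L^\infty(\mathbb T)$ let $$R_H x=P_+fP_+x+P_-gP_+x+P_+\phi P_-x+P_-\psi P_-x\qquad(x\in L^2(\mathbb T)),$$ and let $\mathfrak R_{C(\mathbb T)}$ be the operator-norm closure of the set of all finite sums of finite products $\sum_{i=1}^n\prod_{j=1}^m R_{H_{ij}}$, where the $H_{ij}$ are $2\times2$ matrices with entries in $C(\mathbb T)$. For $w$ in the open unit disk let $k_w(z)=\sqrt{1-|w|^2}/(1-\bar w z)$. For a Fredholm operator $T$ put $\operatorname{ind}T=\dim\ker T-\dim\ker T^*$. For an invertible $f\in C(\mathbb T)$ let $\sharp(f)=\frac1{2\pi i}\int_{f(\mathbb T)}\frac{dz}{z}$ be its winding number about the origin, that is, $\sharp(f)=\frac{1}{2\pi i}(a(2\pi)-a(0))$ for any continuous $a:\mathbb R\to\mathbb C$ with $e^{a(\theta)}=f(e^{i\theta})$. Let $T\in\mathfrak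 R_{C(\mathbb T)}$ be Fredholm. Then the limits $$f_0(\xi)=\lim_{r\to1^-}\langle Tk_{r\xi},k_{r\xi}\rangle,\qquad \psi_0(\xi)=\lim_{r\to1^-}\langle T\,\bar z\bar k_{r\xi},\bar z\bar k_{r\xi}\rangle$$ exist for every $\xi\in\mathbb T$, the functions $f_0,\psi_0$ are invertible elements of $C(\mathbb T)$, and: 1. the operator $B=R_{\operatorname{diag}(f_0^{-1},\psi_0^{-1})}$ is a regularizer of $T$, i.e. $BT-I$ and $TB-I$ are compact; 2. $\operatorname{ind}T=\sharp(\psi_0)-\sharp(f_0)$. In particular, if $H=\begin{pmatrix} f&\phi\\ g&\psi\end{pmatrix}$ has entries in $C(\mathbb T)$ and $R_H$ is Fredholm, then $f$ and $\psi$ are invertible in $C(\mathbb T)$ and $\operatorname{ind}R_H=\sharp(\psi)-\sharp(f)$. -/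

import Mathlib

open MeasureTheory Filter Topology
open scoped Real ENNReal

noncomputable section

namespace GSIO

/-- The period `2π` is positive. -/
instance factTwoPiPos : Fact (0 < 2 * π) := ⟨Real.two_pi_pos⟩

/-- The unit circle `𝕋`, parametrized by the angle `θ ∈ ℝ / 2πℤ`; the corresponding point of the
complex plane is `e^{iθ}`, see `pt`. -/
abbrev Torus : Type := AddCircle (2 * π)

/-- The point `e^{iθ}` of the complex plane. -/
def pt (θ : Torus) : ℂ := (AddCircle.toCircle θ : ℂ)

/-- Normalized Lebesgue measure `dθ / 2π` on the circle. -/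
abbrev circleMeasure : Measure Torus := AddCircle.haarAddCircle

/-- The Hilbert space `L²(𝕋)`. -/
abbrev L2 : Type := Lp ℂ 2 circleMeasure

/-- The space `L^∞(𝕋)`. -/
abbrev Linf : Type := Lp ℂ ∞ circleMeasure

/-- The inclusion of `C(𝕋)` into `L^∞(𝕋)`. -/
def contToLinf (f : C(Torus, ℂ)) : Linf := ContinuousMap.toLp ∞ circleMeasure ℂ f

/-- The Hardy space `H²`: the functions in `L²(𝕋)` all of whose Fourier coefficients of negative
index vanish. -/
def hardySpace : Submodule ℂ L2 where
  carrier := {x | ∀ n : ℤ, n < 0 → fourierCoeff x n = 0}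
  zero_mem' n _ := by rw [← fourierBasis_repr]; simp
  add_mem' {x y} hx hy n hn := by
    rw [← fourierBasis_repr, map_add, lp.coeFn_add, Pi.add_apply, fourierBasis_repr,
      fourierBasis_repr, hx n hn, hy n hn, add_zero]
  smul_mem' c x hx n hn := by
    rw [← fourierBasis_repr, map_smul, lp.coeFn_smul, Pi.smul_apply, fourierBasis_repr,
      hx n hn, smul_zero]

theorem isClosed_hardySpace : IsClosed (hardySpace : Set L2) := by
  have h : (hardySpace : Set L2) =
      ⋂ n : ℤ, ⋂ _ : n < 0, {x : L2 | inner ℂ (fourierBasis (T := 2 * π) n) x = 0} := by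
    ext x
    simp only [Set.mem_iInter, Set.mem_ofPred_eq, ← HilbertBasis.repr_apply_apply,
      fourierBasis_repr]
    rfl
  rw [h]
  exact isClosed_iInter fun n => isClosed_iInter fun _ =>
    isClosed_eq (continuous_const.inner continuous_id) continuous_const

instance completeSpace_hardySpace : CompleteSpace hardySpace :=
  isClosed_hardySpace.completeSpace_coe

/-- The Riesz projection `P₊`: the orthogonal projection of `L²(𝕋)` onto `H²`. -/
def Pplus : L2 →L[ℂ] L2 := hardySpace.starProjection

/-- The complementary projection `P₋ = I - P₊`. -/
def Pminus : L2 →L[ℂ] L2 := 1 - Pplus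

/-- The operator `x ↦ f x` on `L²(𝕋)` of multiplication by `f ∈ L^∞(𝕋)`. -/
def mulOp (f : Linf) : L2 →L[ℂ] L2 :=
  (ContinuousLinearMap.mul ℂ ℂ).holderL circleMeasure ∞ 2 2 f

/-- The generalized singular integral operator
`R_H = P₊ f P₊ + P₋ g P₊ + P₊ φ P₋ + P₋ ψ P₋` with (bounded) symbol `H = (f, φ; g, ψ)`. -/
def gsio (H : Matrix (Fin 2) (Fin 2) Linf) : L2 →L[ℂ] L2 :=
  Pplus * mulOp (H 0 0) * Pplus + Pminus * mulOp (H 1 0) * Pplus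
    + Pplus * mulOp (H 0 1) * Pminus + Pminus * mulOp (H 1 1) * Pminus

/-- The generalized singular integral operator with continuous symbol. -/
def gsioC (H : Matrix (Fin 2) (Fin 2) C(Torus, ℂ)) : L2 →L[ℂ] L2 := gsio (H.map contToLinf)

/-- The algebra `ℜ_A`: the operator-norm closure of the set of all finite sums of finite products
`∑_{i=1}^n ∏_{j=1}^m R_{H_{ij}}` (the product being ordered by increasing `j`), where the symbols
`H_{ij}` have all their entries in `A ⊆ L^∞(𝕋)`. -/
def gsioAlgebra (A : Set Linf) : Set (L2 →L[ℂ] L2) :=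
  closure {S | ∃ (n m : ℕ) (H : Fin n → Fin m → Matrix (Fin 2) (Fin 2) Linf),
    (∀ i j k l, H i j k l ∈ A) ∧ S = ∑ i, (List.ofFn fun j => gsio (H i j)).prod}

/-- The algebra `ℜ_{C(𝕋)}`. -/
def gsioAlgebraC : Set (L2 →L[ℂ] L2) := gsioAlgebra (Set.range contToLinf)

theorem one_sub_conj_mul_pt_ne_zero {w : ℂ} (hw : ‖w‖ < 1) (θ : Torus) :
    1 - (starRingEnd ℂ) w * pt θ ≠ 0 := by
  intro h
  have h1 : (starRingEnd ℂ) w * pt θ = 1 := (sub_eq_zero.mp h).symm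
  have h2 := congrArg norm h1
  rw [norm_mul, RCLike.norm_conj, pt, Circle.norm_coe, mul_one, norm_one] at h2
  exact hw.ne h2

/-- The normalized reproducing kernel `k_w(ξ) = √(1 - |w|²) / (1 - w̄ ξ)`, `ξ ∈ 𝕋`, of `H²` at a
point `w` of the open unit disk. -/
def kernelFun (w : ℂ) (hw : ‖w‖ < 1) : C(Torus, ℂ) where
  toFun θ := (√(1 - ‖w‖ ^ 2) : ℂ) / (1 - (starRingEnd ℂ) w * pt θ)
  continuous_toFun := by
    refine Continuous.div continuous_const ?_ (one_sub_conj_mul_pt_ne_zero hw)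
    have : Continuous pt := continuous_subtype_val.comp AddCircle.continuous_toCircle
    fun_prop

/-- The function `ξ ↦ ξ̄ \overline{k_w(ξ)}` on the circle. -/
def coKernelFun (w : ℂ) (hw : ‖w‖ < 1) : C(Torus, ℂ) where
  toFun θ := (starRingEnd ℂ) (pt θ) * (starRingEnd ℂ) (kernelFun w hw θ)
  continuous_toFun := by
    have : Continuous pt := continuous_subtype_val.comp AddCircle.continuous_toCircle
    fun_prop

open Classical in
/-- `k_w` as an element of `L²(𝕋)` (by convention `0` off the open unit disk). -/
def kernel (w : ℂ) : L2 :=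
  if hw : ‖w‖ < 1 then ContinuousMap.toLp 2 circleMeasure ℂ (kernelFun w hw) else 0

open Classical in
/-- `ξ̄ \overline{k_w}` as an element of `L²(𝕋)` (by convention `0` off the open unit disk). -/
def coKernel (w : ℂ) : L2 :=
  if hw : ‖w‖ < 1 then ContinuousMap.toLp 2 circleMeasure ℂ (coKernelFun w hw) else 0

/-- `f₀` and `ψ₀` are the boundary symbols of `T`: for every `ξ = e^{iθ} ∈ 𝕋`,
`f₀(ξ) = lim_{r → 1⁻} ⟨T k_{rξ}, k_{rξ}⟩` and `ψ₀(ξ) = lim_{r → 1⁻} ⟨T z̄k̄_{rξ}, z̄k̄_{rξ}⟩`.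
The Mathlib inner product is linear in its second argument. -/
def HasBoundarySymbols (T : L2 →L[ℂ] L2) (f₀ ψ₀ : C(Torus, ℂ)) : Prop :=
  ∀ θ : Torus,
    Tendsto (fun r : ℝ => inner ℂ (kernel (r * pt θ)) (T (kernel (r * pt θ))))
      (𝓝[<] 1) (𝓝 (f₀ θ)) ∧
    Tendsto (fun r : ℝ => inner ℂ (coKernel (r * pt θ)) (T (coKernel (r * pt θ))))
      (𝓝[<] 1) (𝓝 (ψ₀ θ))

/-- `B` is a regularizer of `T`: both `BT - I` and `TB - I` are compact. -/
def IsRegularizer (B T : L2 →L[ℂ] L2) : Prop :=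
  IsCompactOperator (B * T - 1 : L2 →L[ℂ] L2) ∧ IsCompactOperator (T * B - 1 : L2 →L[ℂ] L2)

/-- The index `dim ker T - dim ker T*` of a Fredholm operator. -/
def index (T : L2 →L[ℂ] L2) : ℤ :=
  (Module.finrank ℂ T.ker : ℤ) - (Module.finrank ℂ (ContinuousLinearMap.adjoint T).ker : ℤ)

/-- `g` is a continuous logarithm of `θ ↦ f(e^{iθ})` along the real line. -/
def IsLogLift (f : C(Torus, ℂ)ˣ) (g : C(ℝ, ℂ)) : Prop :=
  ∀ t : ℝ, Complex.exp (g t) = (f : C(Torus, ℂ)) (t : Torus)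

theorem unit_apply_ne_zero (f : C(Torus, ℂ)ˣ) (θ : Torus) : (f : C(Torus, ℂ)) θ ≠ 0 := by
  intro h
  have h1 : (f : C(Torus, ℂ)) θ * ((f⁻¹ : C(Torus, ℂ)ˣ) : C(Torus, ℂ)) θ = 1 :=
    congrArg (fun u : C(Torus, ℂ) => u θ) f.mul_inv
  rw [h, zero_mul] at h1
  exact zero_ne_one h1

theorem exists_isLogLift (f : C(Torus, ℂ)ˣ) : ∃ g : C(ℝ, ℂ), IsLogLift f g := by
  obtain ⟨F, ⟨-, hF⟩, -⟩ := Complex.isCoveringMapOn_exp.existsUnique_continuousMap_lifts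
    (⟨fun t : ℝ => (f : C(Torus, ℂ)) (t : Torus),
      (map_continuous _).comp (AddCircle.continuous_mk' _)⟩ : C(ℝ, ℂ)) (a₀ := 0)
    (Complex.exp_log (unit_apply_ne_zero f ((0 : ℝ) : Torus)))
    (fun t => unit_apply_ne_zero f (t : Torus))
  exact ⟨F, fun t => congrFun hF t⟩

theorem exists_windingNumber (f : C(Torus, ℂ)ˣ) :
    ∃ n : ℤ, ∃ g : C(ℝ, ℂ), IsLogLift f g ∧ g (2 * π) - g 0 = 2 * π * Complex.I * n := by
  obtain ⟨g, hg⟩ := exists_isLogLift f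
  have h : Complex.exp (g (2 * π)) = Complex.exp (g 0) := by
    rw [hg, hg, AddCircle.coe_period]; rfl
  obtain ⟨n, hn⟩ := Complex.exp_eq_exp_iff_exists_int.mp h
  exact ⟨n, g, hg, by rw [hn]; ring⟩

/-- The winding number `♯(f) = (1 / 2πi) ∫_{f(𝕋)} dz / z` about the origin of an invertible
element `f` of `C(𝕋)`. As `f` is only continuous, the integral is the increment of a continuous
logarithm of `f` over one turn of the circle: `♯(f) = (g(2π) - g(0)) / 2πi` where `g` is
continuous and `e^{g(θ)} = f(e^{iθ})`. -/
def windingNumber (f : C(Torus, ℂ)ˣ) : ℤ := (exists_windingNumber f).choose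

/-- The winding number does not depend on the continuous logarithm. -/
theorem windingNumber_spec (f : C(Torus, ℂ)ˣ) (g : C(ℝ, ℂ)) (hg : IsLogLift f g) :
    g (2 * π) - g 0 = 2 * π * Complex.I * windingNumber f := by
  obtain ⟨g', hg', h⟩ := (exists_windingNumber f).choose_spec
  have key : ∀ t : ℝ, ∃ k : ℤ, ((g t - g' t) / (2 * π * Complex.I)) = k := fun t => by
    obtain ⟨k, hk⟩ := Complex.exp_eq_exp_iff_exists_int.mp ((hg t).trans (hg' t).symm)
    refine ⟨k, ?_⟩
    rw [hk, add_sub_cancel_left, mul_div_cancel_right₀ _ Complex.two_pi_I_ne_zero]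
  choose k hk using key
  have hk' : Continuous k := by
    rw [(Int.isClosedEmbedding_coe_real.isEmbedding).continuous_iff]
    have : ((fun n : ℤ => (n : ℝ)) ∘ k) =
        fun t => ((g t - g' t) / (2 * π * Complex.I)).re := by
      funext t; simp [hk]
    rw [this]
    fun_prop
  have hc : k (2 * π) = k 0 := PreconnectedSpace.constant inferInstance hk'
  have h0 := hk 0
  have h1 := hk (2 * π)
  rw [hc, ← h0, div_left_inj' Complex.two_pi_I_ne_zero] at h1
  rw [windingNumber, ← h]
  linear_combination h1

end GSIO

end

/-! The off-diagonal corners of a singular integral operator with continuous symbol are negligible,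
because the Riesz projection commutes with multiplication by a continuous function up to a norm
limit of finite rank operators (`rieszCommutator_mem`). Modulo such limits the operator is therefore
`diagOp f ψ`, and these diagonal operators multiply like pairs of functions. The relation
`HasSymbol` records this, and it passes to sums and products.

Passing to norm limits and reading off the symbol both use the normalized kernels `k_{rξ}` and their
conjugate analogues. As `r → 1` they tend weakly to zero and become approximate eigenvectors of
every multiplication (`ConcentratesAt`). Compact errors vanish along them, so they are approximate
eigenvectors of `T` with eigenvalues `f ξ` and `ψ ξ`. This gives the boundary limits, the bound of
the symbol by `‖T‖` that makes the class of operators with a symbol closed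
(`isClosed_exists_hasSymbol`), and the nonvanishing of the symbol when `T` is Fredholm
(`ApproxEigen.ne_zero`). The inverse symbol then yields the regularizer.

The index depends only on the symbol. Splitting off the invertible multiplication by `ψ` reduces it
to that of `diagOp (f * ψ⁻¹) 1`, which is a homomorphism on invertible functions. It vanishes on
exponentials and equals `-1` at `z`. Since every invertible function is `z ^ n * exp a` with `n` its
winding number, the formula follows. -/

noncomputable section

namespace GSIO

/-! ### Index theory modulo the norm closure of the finite rank operators -/

section Index

open Module

variable {E : Type*} [NormedAddCommGroup E] [NormedSpace ℂ E]

/-- The norm closure of the finite rank operators on `E`. -/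
def finiteRankClosure (E : Type*) [NormedAddCommGroup E] [NormedSpace ℂ E] :
    Submodule ℂ (E →L[ℂ] E) :=
  ((LinearMap.finiteRange ℂ E E).comap (ContinuousLinearMap.coeLM ℂ)).topologicalClosure

theorem hasFiniteRange_iff {F : E →L[ℂ] E} :
    (F : E →ₗ[ℂ] E).HasFiniteRange ↔ FiniteDimensional ℂ F.range :=
  LinearMap.hasFiniteRange_iff_range.trans (Submodule.fg_iff_finiteDimensional _)

theorem mem_finiteRankClosure_of_range {F : E →L[ℂ] E} (hF : FiniteDimensional ℂ F.range) :
    F ∈ finiteRankClosure E := by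
  refine Submodule.le_topologicalClosure _ ?_
  exact LinearMap.mem_finiteRange_iff_hasFiniteRange.mpr (hasFiniteRange_iff.mpr hF)

theorem mem_finiteRankClosure_iff {K : E →L[ℂ] E} :
    K ∈ finiteRankClosure E ↔
      ∀ ε > 0, ∃ F : E →L[ℂ] E, FiniteDimensional ℂ F.range ∧ ‖K - F‖ < ε := by
  rw [finiteRankClosure, ← SetLike.mem_coe, Submodule.topologicalClosure_coe,
    Metric.mem_closure_iff]
  simp only [dist_eq_norm, SetLike.mem_coe, Submodule.mem_comap,
    LinearMap.mem_finiteRange_iff_hasFiniteRange, ContinuousLinearMap.coeLM_apply,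
    hasFiniteRange_iff]

theorem mul_mem_finiteRankClosure_left (A : E →L[ℂ] E) {K : E →L[ℂ] E}
    (hK : K ∈ finiteRankClosure E) : A * K ∈ finiteRankClosure E := by
  refine map_mem_closure (f := fun X => A * X) (continuous_const.mul continuous_id) hK ?_
  intro F hF
  exact LinearMap.HasNoetherianRange.comp_left hF (A : E →ₗ[ℂ] E)

theorem mul_mem_finiteRankClosure_right (A : E →L[ℂ] E) {K : E →L[ℂ] E}
    (hK : K ∈ finiteRankClosure E) : K * A ∈ finiteRankClosure E := by
  refine map_mem_closure (f := fun X => X * A) (continuous_id.mul continuous_const) hK ?_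
  intro F hF
  exact LinearMap.HasNoetherianRange.comp_right (u := (A : E →ₗ[ℂ] E)) hF

theorem isCompactOperator_of_mem_finiteRankClosure [CompleteSpace E] {K : E →L[ℂ] E}
    (hK : K ∈ finiteRankClosure E) : IsCompactOperator K := by
  have hc := isClosed_setOfPred_isCompactOperator (σ₁₂ := RingHom.id ℂ) (M₁ := E) (M₂ := E)
  refine closure_minimal ?_ hc hK
  intro F hF
  have hfin : FiniteDimensional ℂ F.range :=
    hasFiniteRange_iff.mp (LinearMap.mem_finiteRange_iff_hasFiniteRange.mp hF)
  have : ProperSpace F.range := FiniteDimensional.proper ℂ _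
  exact (isCompactOperator_of_locallyCompactSpace_dom F.rangeRestrict).clm_comp F.range.subtypeL

/-- `A` has finite dimensional kernel and cokernel, and its algebraic index is `n`. -/
structure HasIndex (A : E →L[ℂ] E) (n : ℤ) : Prop where
  finite_ker : FiniteDimensional ℂ (A : E →ₗ[ℂ] E).ker
  finite_coker : FiniteDimensional ℂ (E ⧸ (A : E →ₗ[ℂ] E).range)
  index_eq : (A : E →ₗ[ℂ] E).index = n

theorem HasIndex.unique {A : E →L[ℂ] E} {m n : ℤ} (hm : HasIndex A m) (hn : HasIndex A n) :
    m = n := hm.index_eq.symm.trans hn.index_eq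

theorem HasIndex.mul {A B : E →L[ℂ] E} {m n : ℤ} (hA : HasIndex A m) (hB : HasIndex B n) :
    HasIndex (A * B) (m + n) := by
  have := hA.finite_ker
  have := hA.finite_coker
  have := hB.finite_ker
  have := hB.finite_coker
  have h : ((A * B : E →L[ℂ] E) : E →ₗ[ℂ] E) = (A : E →ₗ[ℂ] E) ∘ₗ (B : E →ₗ[ℂ] E) := rfl
  refine ⟨?_, ?_, ?_⟩
  · rw [h, LinearMap.ker_comp]; infer_instance
  · rw [h, LinearMap.range_comp]; infer_instance
  · rw [h, LinearMap.index_comp, hA.index_eq, hB.index_eq]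

theorem hasIndex_of_bijective {A : E →L[ℂ] E} (hA : Function.Bijective A) : HasIndex A 0 := by
  have hk : (A : E →ₗ[ℂ] E).ker = ⊥ := LinearMap.ker_eq_bot.mpr hA.1
  have hr : (A : E →ₗ[ℂ] E).range = ⊤ := LinearMap.range_eq_top.mpr hA.2
  refine ⟨by rw [hk]; infer_instance, by rw [hr]; infer_instance, ?_⟩
  exact LinearEquiv.index_eq_zero (e := LinearEquiv.ofBijective (A : E →ₗ[ℂ] E) hA)

theorem hasIndex_of_isUnit {A : E →L[ℂ] E} (hA : IsUnit A) : HasIndex A 0 := by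
  obtain ⟨B, hAB, hBA⟩ := isUnit_iff_exists.mp hA
  refine hasIndex_of_bijective (Function.bijective_iff_has_inverse.mpr ⟨B, ?_, ?_⟩)
  · intro x; exact congrArg (fun C : E →L[ℂ] E => C x) hBA
  · intro x; exact congrArg (fun C : E →L[ℂ] E => C x) hAB

/-- Everything happens on the range `V` of `F`: the kernel of `1 + F` lies in `V`, and since `x` is
congruent to `-F x` modulo the range of `1 + F`, the cokernel is that of the restriction to `V`.
Rank-nullity on `V` then gives index zero. -/
theorem hasIndex_one_add_of_finiteRank {F : E →L[ℂ] E} (hF : FiniteDimensional ℂ F.range) :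
    HasIndex (1 + F) 0 := by
  set A : E →ₗ[ℂ] E := ((1 + F : E →L[ℂ] E) : E →ₗ[ℂ] E) with hA
  have hAx : ∀ x, A x = x + F x := fun x => rfl
  set V : Submodule ℂ E := F.range with hV
  have hFV : ∀ x, F x ∈ V := fun x => LinearMap.mem_range_self _ x
  have hAV : ∀ x ∈ V, A x ∈ V := fun x hx => V.add_mem hx (hFV x)
  have hmem : ∀ x, A x ∈ V → x ∈ V := fun x hx => by
    have := V.sub_mem hx (hFV x)
    rwa [hAx, add_sub_cancel_right] at this
  let g : V →ₗ[ℂ] V := A.restrict hAV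
  let Φ : V →ₗ[ℂ] E ⧸ A.range := A.range.mkQ ∘ₗ V.subtype
  have hkerg : g.ker.map V.subtype = A.ker := by
    ext x
    constructor
    · rintro ⟨y, hy, rfl⟩
      exact congrArg Subtype.val (LinearMap.mem_ker.mp hy)
    · intro hx
      rw [LinearMap.mem_ker] at hx
      refine ⟨⟨x, hmem x (by rw [hx]; exact V.zero_mem)⟩, ?_, rfl⟩
      exact Subtype.ext hx
  have hΦ : Function.Surjective Φ := by
    intro q
    obtain ⟨x, rfl⟩ := Submodule.mkQ_surjective _ q
    refine ⟨-⟨F x, hFV x⟩, ?_⟩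
    refine ((Submodule.Quotient.eq _).mpr ?_).symm
    exact ⟨x, by simp [hAx]⟩
  have hkerΦ : Φ.ker = g.range := by
    ext v
    simp only [Φ, LinearMap.mem_ker, LinearMap.comp_apply, Submodule.mkQ_apply,
      Submodule.Quotient.mk_eq_zero, LinearMap.mem_range]
    constructor
    · rintro ⟨x, hx⟩
      exact ⟨⟨x, hmem x (by rw [hx]; exact v.2)⟩, Subtype.ext hx⟩
    · rintro ⟨y, rfl⟩
      exact ⟨y, rfl⟩
  have hck : FiniteDimensional ℂ A.ker := by rw [← hkerg]; infer_instance
  have hcc : FiniteDimensional ℂ (E ⧸ A.range) := Module.Finite.of_surjective Φ hΦ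
  refine ⟨hck, hcc, ?_⟩
  have h1 := g.finrank_range_add_finrank_ker
  have h2 := Φ.finrank_range_add_finrank_ker
  rw [LinearMap.range_eq_top.mpr hΦ, finrank_top, hkerΦ] at h2
  have h3 : finrank ℂ A.ker = finrank ℂ g.ker := by
    rw [← hkerg]; exact Submodule.finrank_map_subtype_eq _ _
  change A.index = 0
  rw [LinearMap.index_eq_finrank_sub]
  lia

variable [CompleteSpace E]

/-- With `F` of finite rank and `‖K - F‖ < 1`, the operator `u = 1 + (K - F)` is invertible by the
Neumann series, and `1 + K = u (1 + u⁻¹ F)` reduces to the finite rank case. -/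
theorem hasIndex_one_add {K : E →L[ℂ] E} (hK : K ∈ finiteRankClosure E) : HasIndex (1 + K) 0 := by
  obtain ⟨F, hF, hKF⟩ := mem_finiteRankClosure_iff.mp hK 1 one_pos
  have hu : IsUnit (1 + (K - F)) := by
    have := isUnit_one_sub_of_norm_lt_one (x := -(K - F)) (by rwa [norm_neg])
    rwa [sub_neg_eq_add] at this
  obtain ⟨u, hu'⟩ := hu
  have hF' : FiniteDimensional ℂ ((↑u⁻¹ * F : E →L[ℂ] E)).range := by
    have := LinearMap.HasFiniteRange.comp_left
      (hasFiniteRange_iff.mpr hF) ((↑u⁻¹ : E →L[ℂ] E) : E →ₗ[ℂ] E)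
    exact hasFiniteRange_iff.mp this
  have h : 1 + K = ↑u * (1 + ↑u⁻¹ * F) := by
    rw [mul_add, mul_one, Units.mul_inv_cancel_left, hu']; abel
  rw [h]
  simpa using (hasIndex_of_isUnit u.isUnit).mul (hasIndex_one_add_of_finiteRank hF')

/-- The kernel of `A` sits inside that of `B * A`, and its cokernel is a quotient of that of `A *
B`; both products are perturbations of the identity. -/
theorem exists_hasIndex {A B : E →L[ℂ] E} (hBA : B * A - 1 ∈ finiteRankClosure E)
    (hAB : A * B - 1 ∈ finiteRankClosure E) : ∃ n, HasIndex A n := by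
  have h1 := hasIndex_one_add hBA
  have h2 := hasIndex_one_add hAB
  rw [add_sub_cancel] at h1 h2
  have := h1.finite_ker
  have := h2.finite_coker
  have hk : (A : E →ₗ[ℂ] E).ker ≤ ((B * A : E →L[ℂ] E) : E →ₗ[ℂ] E).ker :=
    LinearMap.ker_le_ker_comp (A : E →ₗ[ℂ] E) (B : E →ₗ[ℂ] E)
  have hr : ((A * B : E →L[ℂ] E) : E →ₗ[ℂ] E).range ≤ (A : E →ₗ[ℂ] E).range :=
    LinearMap.range_comp_le_range (B : E →ₗ[ℂ] E) (A : E →ₗ[ℂ] E)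
  exact ⟨_, Submodule.finiteDimensional_of_le hk,
    Module.Finite.of_surjective _ (Submodule.factor_surjective hr), rfl⟩

/-- The index of an operator with a parametrix is stable under perturbations in the closure of the
finite rank operators. -/
theorem HasIndex.congr {A B T : E →L[ℂ] E} {n : ℤ} (hA : HasIndex A n)
    (hBA : B * A - 1 ∈ finiteRankClosure E) (hAB : A * B - 1 ∈ finiteRankClosure E)
    (hT : T - A ∈ finiteRankClosure E) : HasIndex T n := by
  have hBT : B * T - 1 ∈ finiteRankClosure E := by
    have := Submodule.add_mem _ hBA (mul_mem_finiteRankClosure_left B hT)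
    convert this using 1; noncomm_ring
  have hTB : T * B - 1 ∈ finiteRankClosure E := by
    have := Submodule.add_mem _ hAB (mul_mem_finiteRankClosure_right B hT)
    convert this using 1; noncomm_ring
  obtain ⟨m, hm⟩ := exists_hasIndex hBT hTB
  -- `B` is a parametrix of both `A` and `T`, so `p + n = 0 = p + m`.
  obtain ⟨p, hp⟩ := exists_hasIndex hAB hBA
  have h1 := hasIndex_one_add hBA
  have h2 := hasIndex_one_add hBT
  rw [add_sub_cancel] at h1 h2
  have e1 := (hp.mul hA).unique h1
  have e2 := (hp.mul hm).unique h2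
  have : m = n := by lia
  exact this ▸ hm

end Index

/-- The kernel of the adjoint is the orthogonal complement of the range. Closedness of the range
makes this a true complement, hence isomorphic to the algebraic cokernel. -/
theorem index_eq_of_hasIndex {T : L2 →L[ℂ] L2} {n : ℤ} (hT : HasIndex T n)
    (hc : IsClosed (T.range : Set L2)) : index T = n := by
  rw [← hT.index_eq, LinearMap.index_eq_finrank_sub, index, ← ContinuousLinearMap.orthogonal_range]
  have : CompleteSpace T.range := hc.completeSpace_coe
  congr 2
  exact (Submodule.quotientEquivOfIsCompl _ _
    (Submodule.isCompl_orthogonal T.range)).finrank_eq.symm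

/-! ### Monomials and the Riesz projection -/

/-- The trigonometric monomial `z ^ n` as an element of `L²(𝕋)`. -/
abbrev monomial (n : ℤ) : L2 := fourierLp (T := 2 * π) 2 n

theorem fourierBasis_eq_monomial (n : ℤ) : fourierBasis (T := 2 * π) n = monomial n := by
  rw [coe_fourierBasis]

theorem inner_monomial (m n : ℤ) : inner ℂ (monomial m) (monomial n) = if m = n then 1 else 0 :=
  orthonormal_iff_ite.mp (orthonormal_fourier (T := 2 * π)) m n

theorem norm_monomial (n : ℤ) : ‖monomial n‖ = 1 :=
  (orthonormal_fourier (T := 2 * π)).1 n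

theorem mem_of_monomial_mem {S : Submodule ℂ L2} (hS : IsClosed (S : Set L2))
    (h : ∀ n, monomial n ∈ S) (x : L2) : x ∈ S := by
  have hle : (Submodule.span ℂ (Set.range monomial)).topologicalClosure ≤ S :=
    Submodule.topologicalClosure_minimal _
      (Submodule.span_le.mpr (Set.range_subset_iff.mpr h)) hS
  rw [span_fourierLp_closure_eq_top (by norm_num)] at hle
  exact hle trivial

theorem mem_of_fourier_mem {S : Submodule ℂ C(Torus, ℂ)} (hS : IsClosed (S : Set C(Torus, ℂ)))
    (h : ∀ n, fourier n ∈ S) (f : C(Torus, ℂ)) : f ∈ S := by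
  have hle : (Submodule.span ℂ (Set.range (fourier (T := 2 * π)))).topologicalClosure ≤ S :=
    Submodule.topologicalClosure_minimal _
      (Submodule.span_le.mpr (Set.range_subset_iff.mpr h)) hS
  rw [span_fourier_closure_eq_top] at hle
  exact hle trivial

theorem ext_monomial {A B : L2 →L[ℂ] L2} (h : ∀ n, A (monomial n) = B (monomial n)) : A = B := by
  ext1 x
  have := mem_of_monomial_mem (S := (A - B : L2 →L[ℂ] L2).ker)
    (A - B : L2 →L[ℂ] L2).isClosed_ker (fun n => by simp [h n]) x
  simpa [sub_eq_zero] using this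

theorem Pplus_monomial_of_nonneg {n : ℤ} (hn : 0 ≤ n) : Pplus (monomial n) = monomial n := by
  refine Submodule.starProjection_eq_self_iff.mpr ?_
  intro m hm
  rw [← fourierBasis_repr, HilbertBasis.repr_apply_apply, fourierBasis_eq_monomial,
    inner_monomial, if_neg (by lia)]

theorem Pplus_monomial_of_neg {n : ℤ} (hn : n < 0) : Pplus (monomial n) = 0 := by
  refine (Submodule.starProjection_apply_eq_zero_iff _).mpr ?_
  intro x hx
  have := hx n hn
  rw [← fourierBasis_repr, HilbertBasis.repr_apply_apply, fourierBasis_eq_monomial] at this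
  rw [← inner_conj_symm, this, map_zero]

theorem Pplus_mul_Pplus : Pplus * Pplus = Pplus := hardySpace.isIdempotentElem_starProjection

/-! ### Multiplication operators and their commutators with the Riesz projection -/

/-- Multiplication by a continuous function, as a bounded linear function of the symbol. -/
def mulCLM : C(Torus, ℂ) →L[ℂ] (L2 →L[ℂ] L2) :=
  ((ContinuousLinearMap.mul ℂ ℂ).holderL circleMeasure ∞ 2 2).comp
    (ContinuousMap.toLp ∞ circleMeasure ℂ)

theorem coeFn_mulCLM (f : C(Torus, ℂ)) (x : L2) :
    mulCLM f x =ᵐ[circleMeasure] fun θ => f θ * x θ := by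
  have h1 := (ContinuousLinearMap.mul ℂ ℂ).coeFn_holder (r := 2) (contToLinf f) x
  have h2 := ContinuousMap.coeFn_toLp (p := ∞) circleMeasure (𝕜 := ℂ) f
  filter_upwards [h1, h2] with θ h1 h2
  refine Eq.trans h1 ?_
  rw [ContinuousLinearMap.mul_apply', contToLinf, h2]

theorem mulCLM_toLp (f g : C(Torus, ℂ)) :
    mulCLM f (ContinuousMap.toLp 2 circleMeasure ℂ g) =
      ContinuousMap.toLp 2 circleMeasure ℂ (f * g) := by
  refine Lp.ext ?_
  filter_upwards [coeFn_mulCLM f (ContinuousMap.toLp 2 circleMeasure ℂ g),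
    ContinuousMap.coeFn_toLp (p := 2) circleMeasure (𝕜 := ℂ) g,
    ContinuousMap.coeFn_toLp (p := 2) circleMeasure (𝕜 := ℂ) (f * g)] with θ h1 h2 h3
  rw [h1, h2, h3]; rfl

theorem mulCLM_mul (f g : C(Torus, ℂ)) : mulCLM (f * g) = mulCLM f * mulCLM g := by
  ext1 x
  refine Lp.ext ?_
  filter_upwards [coeFn_mulCLM (f * g) x, coeFn_mulCLM g x, coeFn_mulCLM f (mulCLM g x)]
    with θ h1 h2 h3
  rw [mul_apply_eq_comp, h1, h3, h2, ContinuousMap.mul_apply, mul_assoc]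

theorem mulCLM_one : mulCLM 1 = 1 := by
  ext1 x
  refine Lp.ext ?_
  filter_upwards [coeFn_mulCLM 1 x] with θ h1
  rw [h1, ContinuousMap.one_apply, one_mul]; rfl

theorem mulCLM_fourier_monomial (m n : ℤ) :
    mulCLM (fourier m) (monomial n) = monomial (m + n) := by
  rw [monomial, fourierLp, mulCLM_toLp]
  congr 1
  ext θ
  rw [ContinuousMap.mul_apply, fourier_add]

/-- The commutator of the Riesz projection with multiplication by a continuous function. -/
def rieszCommutator : C(Torus, ℂ) →L[ℂ] (L2 →L[ℂ] L2) :=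
  (ContinuousLinearMap.mul ℂ (L2 →L[ℂ] L2) Pplus).comp mulCLM -
    ((ContinuousLinearMap.mul ℂ (L2 →L[ℂ] L2)).flip Pplus).comp mulCLM

theorem rieszCommutator_apply (f : C(Torus, ℂ)) :
    rieszCommutator f = Pplus * mulCLM f - mulCLM f * Pplus := rfl

theorem rieszCommutator_fourier_mem (m : ℤ) :
    rieszCommutator (fourier m) ∈ finiteRankClosure L2 := by
  -- The commutator kills `z ^ n` unless `n` and `m + n` lie on opposite sides of the cut between
  -- `-1` and `0`. In that case `|m + n| ≤ |m|`, so the image stays in this finite dimensional span.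
  let W : Submodule ℂ L2 := Submodule.span ℂ (monomial '' Set.Icc (-|m|) |m|)
  have hW : FiniteDimensional ℂ W :=
    FiniteDimensional.span_of_finite ℂ ((Set.finite_Icc _ _).image _)
  have hmem : ∀ x, rieszCommutator (fourier m) x ∈ W := by
    refine mem_of_monomial_mem (S := W.comap (rieszCommutator (fourier m) : L2 →ₗ[ℂ] L2))
      ((Submodule.closed_of_finiteDimensional W).preimage
        (rieszCommutator (fourier m)).continuous) fun n => ?_
    have key : rieszCommutator (fourier m) (monomial n) =
        Pplus (monomial (m + n)) - mulCLM (fourier m) (Pplus (monomial n)) := by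
      rw [← mulCLM_fourier_monomial]; rfl
    rw [Submodule.mem_comap]
    refine (congrArg (· ∈ W) key).mpr ?_
    have hsub : |m + n| ≤ |m| → monomial (m + n) ∈ W := fun h =>
      Submodule.subset_span ⟨m + n, abs_le.mp h, rfl⟩
    rcases lt_or_ge n 0 with hn | hn <;> rcases lt_or_ge (m + n) 0 with hmn | hmn
    · rw [Pplus_monomial_of_neg hn, Pplus_monomial_of_neg hmn]; simp
    · rw [Pplus_monomial_of_neg hn, Pplus_monomial_of_nonneg hmn, map_zero, sub_zero]
      exact hsub (by grind)
    · rw [Pplus_monomial_of_nonneg hn, Pplus_monomial_of_neg hmn, mulCLM_fourier_monomial, zero_sub]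
      exact W.neg_mem (hsub (by grind))
    · rw [Pplus_monomial_of_nonneg hn, Pplus_monomial_of_nonneg hmn, mulCLM_fourier_monomial]; simp
  refine mem_finiteRankClosure_of_range (Submodule.finiteDimensional_of_le (S₂ := W) ?_)
  rintro _ ⟨x, rfl⟩
  exact hmem x

/-- The commutator is continuous in the symbol and the target is closed, so density of trigonometric
polynomials suffices. -/
theorem rieszCommutator_mem (f : C(Torus, ℂ)) : rieszCommutator f ∈ finiteRankClosure L2 :=
  mem_of_fourier_mem
    (S := (finiteRankClosure L2).comap (rieszCommutator : C(Torus, ℂ) →ₗ[ℂ] (L2 →L[ℂ] L2)))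
    ((Submodule.isClosed_topologicalClosure _).preimage rieszCommutator.continuous)
    rieszCommutator_fourier_mem f

/-- This Hankel corner is `-[P₊, f] P₊`; the opposite corner below is `P₊ [P₊, f]` in the same way.
-/
theorem Pminus_mul_mul_Pplus_mem (f : C(Torus, ℂ)) :
    Pminus * mulCLM f * Pplus ∈ finiteRankClosure L2 := by
  have h := Submodule.neg_mem _ (mul_mem_finiteRankClosure_right Pplus (rieszCommutator_mem f))
  convert h using 1
  rw [rieszCommutator_apply, sub_mul, mul_assoc (mulCLM f), Pplus_mul_Pplus, Pminus]
  noncomm_ring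

theorem Pplus_mul_mul_Pminus_mem (f : C(Torus, ℂ)) :
    Pplus * mulCLM f * Pminus ∈ finiteRankClosure L2 := by
  have h := mul_mem_finiteRankClosure_left Pplus (rieszCommutator_mem f)
  convert h using 1
  rw [rieszCommutator_apply, mul_sub, ← mul_assoc, Pplus_mul_Pplus, Pminus]
  noncomm_ring

/-! ### Diagonal operators and the symbol calculus -/

/-- The diagonal operator `P₊ f P₊ + P₋ ψ P₋`. -/
def diagOp (f ψ : C(Torus, ℂ)) : L2 →L[ℂ] L2 :=
  Pplus * mulCLM f * Pplus + Pminus * mulCLM ψ * Pminus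

theorem gsioC_eq (f g φ ψ : C(Torus, ℂ)) : gsioC !![f, φ; g, ψ] =
    Pplus * mulCLM f * Pplus + Pminus * mulCLM g * Pplus
    + Pplus * mulCLM φ * Pminus + Pminus * mulCLM ψ * Pminus := rfl

theorem gsioC_sub_diagOp_mem (f g φ ψ : C(Torus, ℂ)) :
    gsioC !![f, φ; g, ψ] - diagOp f ψ ∈ finiteRankClosure L2 := by
  have h := Submodule.add_mem _ (Pminus_mul_mul_Pplus_mem g) (Pplus_mul_mul_Pminus_mem φ)
  convert h using 1
  rw [gsioC_eq, diagOp]; abel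

theorem mulCLM_sub_diagOp_mem (f : C(Torus, ℂ)) :
    mulCLM f - diagOp f f ∈ finiteRankClosure L2 := by
  have h := Submodule.add_mem _ (Pminus_mul_mul_Pplus_mem f) (Pplus_mul_mul_Pminus_mem f)
  convert h using 1
  rw [diagOp, Pminus]; noncomm_ring

theorem Pminus_mul_Pminus : Pminus * Pminus = Pminus := by
  rw [Pminus, sub_mul, mul_sub, mul_sub, Pplus_mul_Pplus]; simp

theorem Pplus_mul_Pminus : Pplus * Pminus = 0 := by
  rw [Pminus, mul_sub, Pplus_mul_Pplus, mul_one, sub_self]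

theorem Pminus_mul_Pplus : Pminus * Pplus = 0 := by
  rw [Pminus, sub_mul, Pplus_mul_Pplus, one_mul, sub_self]

theorem diagOp_one_one : diagOp 1 1 = 1 := by
  rw [diagOp, mulCLM_one, mul_one, mul_one, Pplus_mul_Pplus, Pminus_mul_Pminus, Pminus]; abel

theorem diagOp_zero_zero : diagOp 0 0 = 0 := by
  rw [diagOp, map_zero]; simp

theorem diagOp_add (f ψ f' ψ' : C(Torus, ℂ)) :
    diagOp (f + f') (ψ + ψ') = diagOp f ψ + diagOp f' ψ' := by
  rw [diagOp, diagOp, diagOp, map_add, map_add]; noncomm_ring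

theorem diagOp_sub (f ψ f' ψ' : C(Torus, ℂ)) :
    diagOp (f - f') (ψ - ψ') = diagOp f ψ - diagOp f' ψ' := by
  rw [diagOp, diagOp, diagOp, map_sub, map_sub]; noncomm_ring

theorem continuous_diagOp : Continuous fun p : C(Torus, ℂ) × C(Torus, ℂ) => diagOp p.1 p.2 := by
  have h := mulCLM.continuous
  unfold diagOp
  exact ((continuous_const.mul (h.comp continuous_fst)).mul continuous_const).add
    ((continuous_const.mul (h.comp continuous_snd)).mul continuous_const)

/-- Insert `P₊ + P₋ = 1` between the two multiplications in each corner; the extra terms contain a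
Hankel factor. -/
theorem diagOp_mul_eq (f ψ f' ψ' : C(Torus, ℂ)) :
    diagOp (f * f') (ψ * ψ') = diagOp f ψ * diagOp f' ψ'
      + Pplus * mulCLM f * (Pminus * mulCLM f' * Pplus)
      + Pminus * mulCLM ψ * (Pplus * mulCLM ψ' * Pminus) := by
  have e1 : diagOp f ψ * diagOp f' ψ' = Pplus * mulCLM f * Pplus * mulCLM f' * Pplus
      + Pminus * mulCLM ψ * Pminus * mulCLM ψ' * Pminus := by
    calc diagOp f ψ * diagOp f' ψ'
      _ = Pplus * mulCLM f * (Pplus * Pplus) * mulCLM f' * Pplus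
          + Pplus * mulCLM f * (Pplus * Pminus) * mulCLM ψ' * Pminus
          + Pminus * mulCLM ψ * (Pminus * Pplus) * mulCLM f' * Pplus
          + Pminus * mulCLM ψ * (Pminus * Pminus) * mulCLM ψ' * Pminus := by
        simp only [diagOp, mul_add, add_mul, mul_assoc]; abel
      _ = _ := by
        rw [Pplus_mul_Pplus, Pplus_mul_Pminus, Pminus_mul_Pplus, Pminus_mul_Pminus]; simp
  rw [e1, diagOp, mulCLM_mul, mulCLM_mul, Pminus]
  noncomm_ring

theorem diagOp_mul_sub_mem (f ψ f' ψ' : C(Torus, ℂ)) :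
    diagOp f ψ * diagOp f' ψ' - diagOp (f * f') (ψ * ψ') ∈ finiteRankClosure L2 := by
  have h := Submodule.neg_mem _ (Submodule.add_mem _
    (mul_mem_finiteRankClosure_left (Pplus * mulCLM f) (Pminus_mul_mul_Pplus_mem f'))
    (mul_mem_finiteRankClosure_left (Pminus * mulCLM ψ) (Pplus_mul_mul_Pminus_mem ψ')))
  convert h using 1
  rw [diagOp_mul_eq]; abel

/-- `T` has the continuous symbol `(f, ψ)`: it equals `P₊ f P₊ + P₋ ψ P₋` modulo the norm closure
of the finite rank operators. -/
def HasSymbol (T : L2 →L[ℂ] L2) (f ψ : C(Torus, ℂ)) : Prop :=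
  T - diagOp f ψ ∈ finiteRankClosure L2

theorem HasSymbol.add {S T : L2 →L[ℂ] L2} {f ψ f' ψ' : C(Torus, ℂ)} (hS : HasSymbol S f ψ)
    (hT : HasSymbol T f' ψ') : HasSymbol (S + T) (f + f') (ψ + ψ') := by
  have h := Submodule.add_mem _ hS hT
  rw [HasSymbol, diagOp_add]
  convert h using 1; abel

theorem HasSymbol.sub {S T : L2 →L[ℂ] L2} {f ψ f' ψ' : C(Torus, ℂ)} (hS : HasSymbol S f ψ)
    (hT : HasSymbol T f' ψ') : HasSymbol (S - T) (f - f') (ψ - ψ') := by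
  have h := Submodule.sub_mem _ hS hT
  rw [HasSymbol, diagOp_sub]
  convert h using 1; abel

/-- With `D`, `D'` the diagonal models, `ST` differs from the model of the product by `(S - D) T + D
(T - D')` plus the defect of multiplicativity of `diagOp`. -/
theorem HasSymbol.mul {S T : L2 →L[ℂ] L2} {f ψ f' ψ' : C(Torus, ℂ)} (hS : HasSymbol S f ψ)
    (hT : HasSymbol T f' ψ') : HasSymbol (S * T) (f * f') (ψ * ψ') := by
  have h := Submodule.add_mem _ (Submodule.add_mem _ (mul_mem_finiteRankClosure_right T hS)
    (mul_mem_finiteRankClosure_left (diagOp f ψ) hT)) (diagOp_mul_sub_mem f ψ f' ψ')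
  rw [HasSymbol]
  convert h using 1; noncomm_ring

theorem hasSymbol_diagOp (f ψ : C(Torus, ℂ)) : HasSymbol (diagOp f ψ) f ψ := by
  rw [HasSymbol, sub_self]; exact Submodule.zero_mem _

theorem hasSymbol_one : HasSymbol 1 1 1 := by
  have h := hasSymbol_diagOp 1 1
  rwa [diagOp_one_one] at h

theorem hasSymbol_zero : HasSymbol 0 0 0 := by
  have h := hasSymbol_diagOp 0 0
  rwa [diagOp_zero_zero] at h

theorem HasSymbol.sub_mem {S T : L2 →L[ℂ] L2} {f ψ : C(Torus, ℂ)} (hS : HasSymbol S f ψ)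
    (hT : HasSymbol T f ψ) : S - T ∈ finiteRankClosure L2 := by
  have h := Submodule.sub_mem _ hS hT
  rwa [sub_sub_sub_cancel_right] at h

theorem hasSymbol_gsioC (f g φ ψ : C(Torus, ℂ)) : HasSymbol (gsioC !![f, φ; g, ψ]) f ψ :=
  gsioC_sub_diagOp_mem f g φ ψ

theorem exists_hasSymbol_gsio {H : Matrix (Fin 2) (Fin 2) Linf}
    (hH : ∀ k l, H k l ∈ Set.range contToLinf) : ∃ f ψ, HasSymbol (gsio H) f ψ := by
  choose h hh using hH
  refine ⟨h 0 0, h 1 1, ?_⟩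
  have : H = (Matrix.of h).map contToLinf :=
    Matrix.ext fun k l => (hh k l).symm
  have e : gsio H = gsioC !![h 0 0, h 0 1; h 1 0, h 1 1] := by
    rw [this, gsioC]; rfl
  rw [e]
  exact hasSymbol_gsioC _ _ _ _

theorem exists_hasSymbol_prod {l : List (L2 →L[ℂ] L2)}
    (h : ∀ A ∈ l, ∃ f ψ, HasSymbol A f ψ) : ∃ f ψ, HasSymbol l.prod f ψ := by
  induction l with
  | nil => exact ⟨1, 1, hasSymbol_one⟩
  | cons A l ih =>
    obtain ⟨f, ψ, hA⟩ := h A List.mem_cons_self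
    obtain ⟨f', ψ', hl⟩ := ih fun B hB => h B (List.mem_cons_of_mem _ hB)
    rw [List.prod_cons]
    exact ⟨_, _, hA.mul hl⟩

theorem exists_hasSymbol_sum {ι : Type*} (s : Finset ι) {A : ι → L2 →L[ℂ] L2}
    (h : ∀ i, ∃ f ψ, HasSymbol (A i) f ψ) : ∃ f ψ, HasSymbol (∑ i ∈ s, A i) f ψ := by
  choose f ψ hA using h
  refine ⟨∑ i ∈ s, f i, ∑ i ∈ s, ψ i, ?_⟩
  induction s using Finset.cons_induction with
  | empty => exact hasSymbol_zero
  | cons i s hi ih =>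
    simp only [Finset.sum_cons]
    exact (hA i).add ih

/-! ### Fourier expansions of the kernels -/

section Kernels

/-- Neumann series in the Banach algebra `C(𝕋)`, which expands both kernel families uniformly from
the equation they satisfy. -/
theorem geometric_hasSum {x : C(Torus, ℂ)} (hx : ‖x‖ < 1) {u c : C(Torus, ℂ)}
    (hu : u * (1 - x) = c) : HasSum (fun n : ℕ => c * x ^ n) u := by
  have hs := summable_geometric_of_norm_lt_one hx
  have h := hs.hasSum.mul_left c
  rwa [← hu, mul_assoc, mul_comm (1 - x), geom_series_mul_neg x hx, mul_one, hu] at h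

theorem norm_smul_fourier (a : ℂ) (n : ℤ) : ‖a • fourier (T := 2 * π) n‖ = ‖a‖ := by
  rw [norm_smul, fourier_norm, mul_one]

theorem fourier_pow (m : ℤ) (n : ℕ) :
    fourier (T := 2 * π) m ^ n = fourier (m * n) := by
  induction n with
  | zero => ext θ; simp
  | succ n ih =>
    ext θ
    rw [pow_succ, ih, ContinuousMap.mul_apply, ← fourier_add, Nat.cast_succ, mul_add, mul_one]

theorem fourier_one_apply (θ : Torus) : fourier 1 θ = pt θ := fourier_one

theorem fourier_neg_one_apply (θ : Torus) : fourier (-1) θ = (starRingEnd ℂ) (pt θ) := by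
  rw [fourier_neg, fourier_one_apply]

theorem norm_pt (θ : Torus) : ‖pt θ‖ = 1 := Circle.norm_coe _

theorem kernelFun_mul {w : ℂ} (hw : ‖w‖ < 1) :
    kernelFun w hw * (1 - (starRingEnd ℂ) w • fourier 1) =
      (√(1 - ‖w‖ ^ 2) : ℂ) • fourier 0 := by
  ext θ
  simp only [ContinuousMap.mul_apply, ContinuousMap.sub_apply, ContinuousMap.one_apply,
    ContinuousMap.smul_apply, fourier_one_apply, smul_eq_mul, fourier_zero, mul_one]
  exact div_mul_cancel₀ _ (one_sub_conj_mul_pt_ne_zero hw θ)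

theorem coKernelFun_mul {w : ℂ} (hw : ‖w‖ < 1) :
    coKernelFun w hw * (1 - w • fourier (-1)) = (√(1 - ‖w‖ ^ 2) : ℂ) • fourier (-1) := by
  ext θ
  have h := congrArg (fun u : C(Torus, ℂ) => (starRingEnd ℂ) (u θ)) (kernelFun_mul hw)
  simp only [ContinuousMap.mul_apply, ContinuousMap.sub_apply, ContinuousMap.one_apply,
    ContinuousMap.smul_apply, fourier_one_apply, smul_eq_mul, fourier_zero, mul_one, map_mul,
    map_sub, map_one, Complex.conj_conj, Complex.conj_ofReal] at h
  simp only [ContinuousMap.mul_apply, ContinuousMap.sub_apply, ContinuousMap.one_apply,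
    ContinuousMap.smul_apply, fourier_neg_one_apply, smul_eq_mul]
  rw [← h, coKernelFun, ContinuousMap.coe_mk]
  ring

theorem toLp_fourier (n : ℤ) :
    ContinuousMap.toLp 2 circleMeasure ℂ (fourier n) = monomial n := rfl

theorem hasSum_kernel {w : ℂ} (hw : ‖w‖ < 1) :
    HasSum (fun n : ℕ => ((√(1 - ‖w‖ ^ 2) : ℂ) * (starRingEnd ℂ) w ^ n) • monomial n)
      (kernel w) := by
  have hx : ‖(starRingEnd ℂ) w • fourier (T := 2 * π) 1‖ < 1 := by
    rwa [norm_smul_fourier, RCLike.norm_conj]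
  have h := (geometric_hasSum hx (kernelFun_mul hw)).mapL (ContinuousMap.toLp 2 circleMeasure ℂ)
  rw [kernel, dif_pos hw]
  convert h using 2 with n
  rw [← toLp_fourier, ← map_smul, smul_pow, fourier_pow, smul_mul_smul_comm]
  congr 2
  ext θ
  rw [ContinuousMap.mul_apply, ← fourier_add, zero_add, one_mul]

theorem hasSum_coKernel {w : ℂ} (hw : ‖w‖ < 1) :
    HasSum (fun n : ℕ => ((√(1 - ‖w‖ ^ 2) : ℂ) * w ^ n) • monomial (-1 - n))
      (coKernel w) := by
  have hx : ‖w • fourier (T := 2 * π) (-1)‖ < 1 := by rwa [norm_smul_fourier]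
  have h := (geometric_hasSum hx (coKernelFun_mul hw)).mapL
    (ContinuousMap.toLp 2 circleMeasure ℂ)
  rw [coKernel, dif_pos hw]
  convert h using 2 with n
  rw [← toLp_fourier, ← map_smul, smul_pow, fourier_pow, smul_mul_smul_comm]
  congr 2
  ext θ
  rw [ContinuousMap.mul_apply, ← fourier_add, neg_one_mul, sub_eq_add_neg]

theorem Pplus_kernel {w : ℂ} (hw : ‖w‖ < 1) : Pplus (kernel w) = kernel w := by
  have h := (hasSum_kernel hw).mapL Pplus
  simp only [map_smul, Pplus_monomial_of_nonneg (Int.natCast_nonneg _)] at h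
  exact h.unique (hasSum_kernel hw)

theorem Pplus_coKernel {w : ℂ} (hw : ‖w‖ < 1) : Pplus (coKernel w) = 0 := by
  have h := (hasSum_coKernel hw).mapL Pplus
  have hn : ∀ n : ℕ, Pplus (monomial (-1 - n)) = 0 := fun n => Pplus_monomial_of_neg (by lia)
  simp only [map_smul, hn, smul_zero] at h
  exact h.unique hasSum_zero

-- One computation serves both families: `σ n = n` with `a = w̄` for the kernel, and `σ n = -1 - n`
-- with `a = w` for the conjugate kernel.
variable {σ : ℕ → ℤ} {a : ℂ} {c : ℝ} {u : L2}

theorem inner_monomial_of_hasSum (hσ : Function.Injective σ)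
    (hu : HasSum (fun n : ℕ => ((c : ℂ) * a ^ n) • monomial (σ n)) u) (n : ℕ) :
    inner ℂ (monomial (σ n)) u = c * a ^ n := by
  have h := hu.mapL (innerSL ℂ (monomial (σ n)))
  refine h.unique ((hasSum_ite_eq n ((c : ℂ) * a ^ n)).congr_fun fun k => ?_)
  rw [innerSL_apply_apply, inner_smul_right, inner_monomial]
  by_cases hk : k = n
  · simp [hk]
  · rw [if_neg fun h => hk (hσ h).symm, if_neg hk, mul_zero]

theorem norm_inner_monomial_le_of_hasSum (hσ : Function.Injective σ) (ha : ‖a‖ < 1) (hc : 0 ≤ c)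
    (hu : HasSum (fun n : ℕ => ((c : ℂ) * a ^ n) • monomial (σ n)) u) (m : ℤ) :
    ‖(inner ℂ (monomial m) u : ℂ)‖ ≤ c := by
  by_cases hm : ∃ n, σ n = m
  · obtain ⟨n, rfl⟩ := hm
    rw [inner_monomial_of_hasSum hσ hu, norm_mul, norm_pow, Complex.norm_real, Real.norm_eq_abs,
      abs_of_nonneg hc]
    exact mul_le_of_le_one_right hc (pow_le_one₀ (norm_nonneg _) ha.le)
  · have h := hu.mapL (innerSL ℂ (monomial m))
    have h0 : ∀ n, innerSL ℂ (monomial m) (((c : ℂ) * a ^ n) • monomial (σ n)) = 0 := fun n => by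
      rw [innerSL_apply_apply, inner_smul_right, inner_monomial,
        if_neg fun h => hm ⟨n, h.symm⟩, mul_zero]
    simp only [h0] at h
    have := h.unique hasSum_zero
    rw [innerSL_apply_apply] at this
    rw [this, norm_zero]
    exact hc

/-- Pairing the expansion with `u` itself gives Parseval: `‖u‖²` is the geometric series `∑ (1 -
|a|²) |a|^{2n} = 1`. -/
theorem norm_eq_one_of_hasSum (hσ : Function.Injective σ) (ha : ‖a‖ < 1) (hc : c ^ 2 = 1 - ‖a‖ ^ 2)
    (hu : HasSum (fun n : ℕ => ((c : ℂ) * a ^ n) • monomial (σ n)) u) : ‖u‖ = 1 := by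
  have h := hu.mapL (innerSL ℂ u)
  have hterm : ∀ n, innerSL ℂ u (((c : ℂ) * a ^ n) • monomial (σ n)) =
      (((1 - ‖a‖ ^ 2) * (‖a‖ ^ 2) ^ n : ℝ) : ℂ) := fun n => by
    rw [innerSL_apply_apply, inner_smul_right, ← inner_conj_symm,
      inner_monomial_of_hasSum hσ hu, Complex.mul_conj', norm_mul, norm_pow, Complex.norm_real,
      Real.norm_eq_abs, ← hc, ← Complex.ofReal_pow, mul_pow, sq_abs, ← pow_mul, ← pow_mul,
      mul_comm n 2]
  simp only [hterm] at h
  have ha2 : ‖a‖ ^ 2 < 1 := by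
    have := norm_nonneg a
    nlinarith
  have hg := (hasSum_geometric_of_lt_one (sq_nonneg ‖a‖) ha2).mul_left (1 - ‖a‖ ^ 2)
  rw [mul_inv_cancel₀ (by linarith)] at hg
  have h1 := h.unique (Complex.hasSum_ofReal.mpr hg)
  rw [innerSL_apply_apply, inner_self_eq_norm_sq_to_K] at h1
  have h2 : ‖u‖ ^ 2 = 1 := Complex.ofReal_injective (by push_cast; exact h1)
  exact (pow_eq_one_iff_of_nonneg (norm_nonneg u) two_ne_zero).mp h2

end Kernels

/-! ### Concentration of the kernels at boundary points -/

/-- Radial approach to the boundary of the unit disk. -/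
abbrev radial : Filter ℝ := 𝓝[<] 1

/-- The unit vectors `u r` concentrate at the point `θ` as `r → 1⁻`: they converge weakly to zero
and are approximate eigenvectors of multiplication by every continuous function. -/
structure ConcentratesAt (u : ℝ → L2) (θ : Torus) : Prop where
  norm_eq_one : ∀ᶠ r in radial, ‖u r‖ = 1
  tendsto_inner : ∀ x, Tendsto (fun r => (inner ℂ x (u r) : ℂ)) radial (𝓝 0)
  tendsto_mul : ∀ f : C(Torus, ℂ),
    Tendsto (fun r => mulCLM f (u r) - f θ • u r) radial (𝓝 0)

/-- Pointwise convergence to zero of an eventually bounded family of linear maps is inherited by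
closures. -/
theorem isClosed_setOf_tendsto_zero {ι X Y : Type*} [SeminormedAddCommGroup X]
    [SeminormedAddCommGroup Y] {l : Filter ι} {A : ι → X → Y} (C : ℝ)
    (hA : ∀ᶠ r in l, ∀ x y, ‖A r x - A r y‖ ≤ C * ‖x - y‖) :
    IsClosed {x | Tendsto (fun r => A r x) l (𝓝 0)} := by
  refine isClosed_of_closure_subset fun x hx => ?_
  rw [Set.mem_ofPred_eq, Metric.tendsto_nhds]
  intro ε hε
  -- Using `|C| + 1` keeps the denominator positive for every real `C`.
  obtain ⟨y, hy, hxy⟩ := Metric.mem_closure_iff.mp hx (ε / (2 * (|C| + 1))) (by positivity)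
  filter_upwards [hA, Metric.tendsto_nhds.mp hy (ε / 2) (by positivity)] with r h1 h2
  rw [dist_zero_right] at h2 ⊢
  rw [dist_eq_norm, lt_div_iff₀ (by positivity)] at hxy
  have h3 : C * ‖x - y‖ ≤ |C| * ‖x - y‖ :=
    mul_le_mul_of_nonneg_right (le_abs_self C) (norm_nonneg _)
  have h4 := norm_sub_norm_le (A r x) (A r y)
  have h5 := h1 x y
  nlinarith [norm_nonneg (x - y)]

theorem tendsto_inner_zero_of_monomial {u : ℝ → L2} (h1 : ∀ᶠ r in radial, ‖u r‖ = 1)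
    (h : ∀ n, Tendsto (fun r => (inner ℂ (monomial n) (u r) : ℂ)) radial (𝓝 0)) (x : L2) :
    Tendsto (fun r => (inner ℂ x (u r) : ℂ)) radial (𝓝 0) := by
  let S : Submodule ℂ L2 :=
    { carrier := {x | Tendsto (fun r => (inner ℂ x (u r) : ℂ)) radial (𝓝 0)}
      add_mem' := fun {x y} hx hy => by
        simpa only [Set.mem_ofPred_eq, inner_add_left, add_zero] using Tendsto.add hx hy
      zero_mem' := by
        simpa only [Set.mem_ofPred_eq, inner_zero_left] using tendsto_const_nhds
      smul_mem' := fun c x hx => by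
        simpa only [Set.mem_ofPred_eq, inner_smul_left, mul_zero] using
          Tendsto.const_mul ((starRingEnd ℂ) c) hx }
  refine mem_of_monomial_mem (S := S) ?_ h x
  refine isClosed_setOf_tendsto_zero 1 ?_
  filter_upwards [h1] with r hr x y
  rw [← inner_sub_left, one_mul]
  simpa [hr] using norm_inner_le_norm (𝕜 := ℂ) (x - y) (u r)

theorem norm_mulCLM_le (f : C(Torus, ℂ)) : ‖mulCLM f‖ ≤ ‖mulCLM‖ * ‖f‖ := mulCLM.le_opNorm f

theorem fourier_neg_mul_fourier (m : ℤ) : fourier (T := 2 * π) (-m) * fourier m = 1 := by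
  ext θ
  rw [ContinuousMap.mul_apply, ← fourier_add]
  simp

theorem tendsto_mulCLM_fourier_neg {u : ℝ → L2} {θ : Torus} {m : ℤ}
    (h : Tendsto (fun r => mulCLM (fourier m) (u r) - fourier m θ • u r) radial (𝓝 0)) :
    Tendsto (fun r => mulCLM (fourier (-m)) (u r) - fourier (-m) θ • u r) radial (𝓝 0) := by
  have h2 := ((mulCLM (fourier (-m))).continuous.tendsto 0).comp h
  rw [map_zero] at h2
  -- So far `u - ζ^m z^{-m} u → 0`, where `ζ` is the point at angle `θ`; multiplying by `-ζ^{-m}`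
  -- gives the claim.
  have h3 := h2.const_smul (-fourier (-m) θ)
  rw [smul_zero] at h3
  refine h3.congr fun r => ?_
  have e2 : fourier (-m) θ * fourier m θ = 1 :=
    congrArg (fun f : C(Torus, ℂ) => f θ) (fourier_neg_mul_fourier m)
  have e3 : mulCLM (fourier (-m)) (mulCLM (fourier m) (u r)) = u r := by
    rw [← mul_apply_eq_comp, ← mulCLM_mul, fourier_neg_mul_fourier, mulCLM_one]; rfl
  rw [Function.comp_apply, map_sub, map_smul, e3, neg_smul, smul_sub, smul_smul, e2, one_smul,
    neg_sub]

/-- The functions with this property are closed under products and form a closed subspace. They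
contain `z`, hence `z⁻¹`, hence all of `C(𝕋)`. -/
theorem tendsto_mulCLM_sub_of_fourier_one {u : ℝ → L2} {θ : Torus}
    (h1 : ∀ᶠ r in radial, ‖u r‖ = 1)
    (h : Tendsto (fun r => mulCLM (fourier 1) (u r) - pt θ • u r) radial (𝓝 0))
    (f : C(Torus, ℂ)) : Tendsto (fun r => mulCLM f (u r) - f θ • u r) radial (𝓝 0) := by
  have hmul : ∀ f g : C(Torus, ℂ), Tendsto (fun r => mulCLM f (u r) - f θ • u r) radial (𝓝 0) →
      Tendsto (fun r => mulCLM g (u r) - g θ • u r) radial (𝓝 0) →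
      Tendsto (fun r => mulCLM (f * g) (u r) - (f * g) θ • u r) radial (𝓝 0) := by
    intro f g hf hg
    have h2 := ((mulCLM f).continuous.tendsto 0).comp hg
    rw [map_zero] at h2
    have h3 := h2.add (hf.const_smul (g θ))
    rw [smul_zero, add_zero] at h3
    refine h3.congr fun r => ?_
    simp only [Function.comp_apply, map_sub, map_smul, mulCLM_mul, mul_apply_eq_comp,
      ContinuousMap.mul_apply, smul_sub, smul_smul]
    rw [mul_comm (g θ)]; abel
  have hfour : ∀ n, Tendsto (fun r => mulCLM (fourier n) (u r) - fourier n θ • u r)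
      radial (𝓝 0) := by
    have hone : Tendsto (fun r => mulCLM (fourier 1) (u r) - fourier 1 θ • u r) radial (𝓝 0) := by
      simpa only [fourier_one_apply] using h
    have hneg := tendsto_mulCLM_fourier_neg hone
    have hadd : ∀ m n : ℤ, fourier (T := 2 * π) (m + n) = fourier m * fourier n := fun m n => by
      ext θ; rw [ContinuousMap.mul_apply, fourier_add]
    intro n
    induction n using Int.induction_on with
    | zero =>
      have : fourier (T := 2 * π) 0 = 1 := by ext; simp
      simp [this, mulCLM_one]
    | succ n ih => rw [hadd]; exact hmul _ _ ih hone
    | pred n ih => rw [sub_eq_add_neg, hadd]; exact hmul _ _ ih hneg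
  let S : Submodule ℂ C(Torus, ℂ) :=
    { carrier := {f | Tendsto (fun r => mulCLM f (u r) - f θ • u r) radial (𝓝 0)}
      add_mem' := fun {f g} hf hg => by
        have h2 := Tendsto.add hf hg
        rw [add_zero] at h2
        refine h2.congr fun r => ?_
        simp only [map_add, add_apply, ContinuousMap.add_apply, add_smul]
        abel
      zero_mem' := by simp
      smul_mem' := fun c f hf => by
        have h2 := Tendsto.const_smul hf c
        rw [smul_zero] at h2
        refine h2.congr fun r => ?_
        simp only [map_smul, smul_apply, ContinuousMap.smul_apply, smul_sub, smul_smul,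
          smul_eq_mul] }
  refine mem_of_fourier_mem (S := S) ?_ hfour f
  -- The summand `‖mulCLM‖` bounds the multiplication, and `1` the evaluation at `θ`.
  refine isClosed_setOf_tendsto_zero (‖mulCLM‖ + 1) ?_
  filter_upwards [h1] with r hr f g
  have e : mulCLM f (u r) - f θ • u r - (mulCLM g (u r) - g θ • u r) =
      mulCLM (f - g) (u r) - (f - g) θ • u r := by
    simp only [map_sub, sub_apply, ContinuousMap.sub_apply, sub_smul]
    abel
  rw [e]
  have b1 := (mulCLM (f - g)).le_opNorm (u r)
  have b2 := norm_mulCLM_le (f - g)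
  have b3 := (f - g).norm_coe_le_norm θ
  have b4 := norm_sub_le (mulCLM (f - g) (u r)) ((f - g) θ • u r)
  rw [norm_smul, hr, mul_one] at b4
  rw [hr, mul_one] at b1
  linarith

theorem eventually_radial : ∀ᶠ r in radial, 0 < r ∧ r < 1 := by
  filter_upwards [Ioo_mem_nhdsLT (zero_lt_one' ℝ)] with r hr using hr

theorem norm_radial_mul_pt {r : ℝ} (hr : 0 < r) (θ : Torus) : ‖(r : ℂ) * pt θ‖ = r := by
  rw [norm_mul, norm_pt, mul_one, Complex.norm_real, Real.norm_eq_abs, abs_of_pos hr]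

theorem tendsto_sqrt_radial : Tendsto (fun r : ℝ => √(1 - r ^ 2)) radial (𝓝 0) := by
  have h : Continuous fun r : ℝ => √(1 - r ^ 2) := by fun_prop
  have := (h.tendsto 1).mono_left (nhdsWithin_le_nhds (s := Set.Iio 1))
  simpa using this

theorem tendsto_inner_of_le {u : ℝ → L2} {n : ℤ}
    (h : ∀ᶠ r in radial, ‖(inner ℂ (monomial n) (u r) : ℂ)‖ ≤ √(1 - r ^ 2)) :
    Tendsto (fun r => (inner ℂ (monomial n) (u r) : ℂ)) radial (𝓝 0) :=
  squeeze_zero_norm' h tendsto_sqrt_radial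

/-- Multiplying the resolvent-type identity by `ζ` gives `Z u - ζ u = -ζ √(1 - r²) z^n + (1 - r) Z
u`, and both terms tend to zero. -/
theorem tendsto_sub_of_sub_eq {u : ℝ → L2} {ζ : ℂ} {n : ℤ} {Z : L2 →L[ℂ] L2} (hζ : ‖ζ‖ = 1)
    (h1 : ∀ᶠ r in radial, ‖u r‖ = 1)
    (h : ∀ᶠ r : ℝ in radial,
      u r - (r * (starRingEnd ℂ) ζ) • Z (u r) = (√(1 - r ^ 2) : ℂ) • monomial n) :
    Tendsto (fun r => Z (u r) - ζ • u r) radial (𝓝 0) := by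
  have key : ∀ᶠ r : ℝ in radial, ‖Z (u r) - ζ • u r‖ ≤ √(1 - r ^ 2) + (1 - r) * ‖Z‖ := by
    filter_upwards [eventually_radial, h1, h] with r hr hn e
    have hζ' : ζ * ((r : ℂ) * (starRingEnd ℂ) ζ) = r := by
      have : ζ * (starRingEnd ℂ) ζ = 1 := by rw [Complex.mul_conj', hζ]; simp
      linear_combination (r : ℂ) * this
    have e2 : Z (u r) - ζ • u r =
        (-(ζ * (√(1 - r ^ 2) : ℂ))) • monomial n + (1 - (r : ℂ)) • Z (u r) := by
      rw [neg_smul, mul_smul, ← e, smul_sub, smul_smul, hζ', sub_smul, one_smul]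
      abel
    have n1 : ‖(-(ζ * (√(1 - r ^ 2) : ℂ))) • monomial n‖ = √(1 - r ^ 2) := by
      rw [norm_smul, norm_monomial, norm_neg, norm_mul, hζ, Complex.norm_real,
        Real.norm_eq_abs, abs_of_nonneg (Real.sqrt_nonneg _), one_mul, mul_one]
    have n2 : ‖(1 - (r : ℂ)) • Z (u r)‖ ≤ (1 - r) * ‖Z‖ := by
      have : ‖(1 - (r : ℂ))‖ = 1 - r := by
        rw [← Complex.ofReal_one, ← Complex.ofReal_sub, Complex.norm_real, Real.norm_eq_abs,
          abs_of_pos (by linarith [hr.2])]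
      rw [norm_smul, this]
      refine mul_le_mul_of_nonneg_left ?_ (by linarith [hr.2])
      simpa [hn] using Z.le_opNorm (u r)
    rw [e2]
    exact (norm_add_le _ _).trans (add_le_add n1.le n2)
  refine squeeze_zero_norm' key ?_
  have h2 : Tendsto (fun r : ℝ => (1 - r) * ‖Z‖) radial (𝓝 0) := by
    have h : Continuous fun r : ℝ => (1 - r) * ‖Z‖ := by fun_prop
    simpa using (h.tendsto 1).mono_left (nhdsWithin_le_nhds (s := Set.Iio 1))
  simpa using tendsto_sqrt_radial.add h2

theorem norm_radial_mul_pt_lt_one {r : ℝ} (hr : 0 < r ∧ r < 1) (θ : Torus) :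
    ‖(r : ℂ) * pt θ‖ < 1 := by
  rw [norm_radial_mul_pt hr.1]; exact hr.2

theorem kernel_sub {w : ℂ} (hw : ‖w‖ < 1) :
    kernel w - (starRingEnd ℂ) w • mulCLM (fourier 1) (kernel w) =
      (√(1 - ‖w‖ ^ 2) : ℂ) • monomial 0 := by
  have h := congrArg (ContinuousMap.toLp 2 circleMeasure ℂ) (kernelFun_mul hw)
  rw [map_smul, toLp_fourier] at h
  rw [← h, mul_comm (kernelFun w hw), ← mulCLM_toLp, kernel, dif_pos hw, map_sub, map_smul,
    mulCLM_one]
  rfl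

theorem coKernel_sub {w : ℂ} (hw : ‖w‖ < 1) :
    coKernel w - w • mulCLM (fourier (-1)) (coKernel w) =
      (√(1 - ‖w‖ ^ 2) : ℂ) • monomial (-1) := by
  have h := congrArg (ContinuousMap.toLp 2 circleMeasure ℂ) (coKernelFun_mul hw)
  rw [map_smul, toLp_fourier] at h
  rw [← h, mul_comm (coKernelFun w hw), ← mulCLM_toLp, coKernel, dif_pos hw, map_sub, map_smul,
    mulCLM_one]
  rfl

theorem sq_sqrt_one_sub {r : ℝ} (hr : 0 < r ∧ r < 1) : √(1 - r ^ 2) ^ 2 = 1 - r ^ 2 :=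
  Real.sq_sqrt (by nlinarith [hr.1, hr.2])

theorem concentratesAt_kernel (θ : Torus) :
    ConcentratesAt (fun r => kernel (r * pt θ)) θ := by
  have hw : ∀ r : ℝ, 0 < r ∧ r < 1 → ‖(starRingEnd ℂ) ((r : ℂ) * pt θ)‖ < 1 := fun r hr => by
    rw [RCLike.norm_conj]; exact norm_radial_mul_pt_lt_one hr θ
  have h1 : ∀ᶠ r : ℝ in radial, ‖kernel (r * pt θ)‖ = 1 := by
    filter_upwards [eventually_radial] with r hr
    refine norm_eq_one_of_hasSum Nat.cast_injective (hw r hr) ?_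
      (hasSum_kernel (norm_radial_mul_pt_lt_one hr θ))
    rw [RCLike.norm_conj, norm_radial_mul_pt hr.1, sq_sqrt_one_sub hr]
  refine ⟨h1, tendsto_inner_zero_of_monomial h1 fun n => tendsto_inner_of_le ?_,
    tendsto_mulCLM_sub_of_fourier_one h1 (tendsto_sub_of_sub_eq (n := 0) (norm_pt θ) h1 ?_)⟩
  · filter_upwards [eventually_radial] with r hr
    have := norm_inner_monomial_le_of_hasSum Nat.cast_injective (hw r hr) (Real.sqrt_nonneg _)
      (hasSum_kernel (norm_radial_mul_pt_lt_one hr θ)) n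
    rwa [norm_radial_mul_pt hr.1] at this
  · filter_upwards [eventually_radial] with r hr
    have := kernel_sub (norm_radial_mul_pt_lt_one hr θ)
    rwa [norm_radial_mul_pt hr.1, map_mul, Complex.conj_ofReal] at this

theorem concentratesAt_coKernel (θ : Torus) :
    ConcentratesAt (fun r => coKernel (r * pt θ)) θ := by
  have hσ : Function.Injective fun n : ℕ => (-1 - n : ℤ) := fun m n h => by
    simpa using h
  have h1 : ∀ᶠ r : ℝ in radial, ‖coKernel (r * pt θ)‖ = 1 := by
    filter_upwards [eventually_radial] with r hr
    refine norm_eq_one_of_hasSum hσ (norm_radial_mul_pt_lt_one hr θ) ?_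
      (hasSum_coKernel (norm_radial_mul_pt_lt_one hr θ))
    rw [norm_radial_mul_pt hr.1, sq_sqrt_one_sub hr]
  refine ⟨h1, tendsto_inner_zero_of_monomial h1 fun n => tendsto_inner_of_le ?_,
    tendsto_mulCLM_sub_of_fourier_one h1 ?_⟩
  · filter_upwards [eventually_radial] with r hr
    have := norm_inner_monomial_le_of_hasSum hσ (norm_radial_mul_pt_lt_one hr θ)
      (Real.sqrt_nonneg _) (hasSum_coKernel (norm_radial_mul_pt_lt_one hr θ)) n
    rwa [norm_radial_mul_pt hr.1] at this
  -- The conjugate kernel satisfies its identity with `z̄` in place of `z`, so the estimate is first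
  -- obtained for `z̄` and then inverted.
  · have h2 : Tendsto (fun r : ℝ => mulCLM (fourier (-1)) (coKernel (r * pt θ)) -
        fourier (-1) θ • coKernel (r * pt θ)) radial (𝓝 0) := by
      refine tendsto_sub_of_sub_eq (n := -1) ?_ h1 ?_
      · rw [fourier_neg_one_apply, RCLike.norm_conj, norm_pt]
      · filter_upwards [eventually_radial] with r hr
        have := coKernel_sub (norm_radial_mul_pt_lt_one hr θ)
        rw [fourier_neg_one_apply, Complex.conj_conj]
        rwa [norm_radial_mul_pt hr.1] at this
    have h3 := tendsto_mulCLM_fourier_neg h2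
    simpa only [neg_neg, fourier_one_apply] using h3

/-- A compact operator maps concentrating unit vectors to vectors tending to zero in norm. -/
theorem ConcentratesAt.tendsto_of_isCompactOperator {u : ℝ → L2} {θ : Torus}
    (hu : ConcentratesAt u θ) {K : L2 →L[ℂ] L2} (hK : IsCompactOperator K) :
    Tendsto (fun r => K (u r)) radial (𝓝 0) := by
  obtain ⟨s, hs, hsub⟩ := hK.image_closedBall_subset_compact (𝕜₁ := ℂ) (f := (K : L2 →ₗ[ℂ] L2)) 1
  -- The images stay in a compact set, so it is enough that `0` is their only cluster point; weak
  -- convergence makes any cluster point orthogonal to itself.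
  refine hs.tendsto_nhds_of_unique_mapClusterPt ?_ fun y _ hy => ?_
  · filter_upwards [hu.norm_eq_one] with r hr
    exact hsub ⟨u r, by simp [hr], rfl⟩
  · have h1 : Tendsto (fun r => (inner ℂ y (K (u r)) : ℂ)) radial (𝓝 0) := by
      have := hu.tendsto_inner (ContinuousLinearMap.adjoint K y)
      simpa only [ContinuousLinearMap.adjoint_inner_left] using this
    have h2 : MapClusterPt (inner ℂ y y : ℂ) radial (fun r => (inner ℂ y (K (u r)) : ℂ)) :=
      hy.continuousAt_comp (f := fun x => (inner ℂ y x : ℂ)) (by fun_prop)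
    have h3 : (inner ℂ y y : ℂ) = 0 := eq_of_nhds_neBot (ClusterPt.mono h2 h1)
    exact inner_self_eq_zero.mp h3

theorem Pminus_apply (x : L2) : Pminus x = x - Pplus x := rfl

theorem diagOp_apply (f ψ : C(Torus, ℂ)) (x : L2) :
    diagOp f ψ x = Pplus (mulCLM f (Pplus x)) + Pminus (mulCLM ψ (Pminus x)) := rfl

/-! ### Recovering the symbol from the kernels -/

/-- `c` is an approximate eigenvalue of `T` along the vectors `u r`. -/
def ApproxEigen (T : L2 →L[ℂ] L2) (u : ℝ → L2) (c : ℂ) : Prop :=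
  Tendsto (fun r => T (u r) - c • u r) radial (𝓝 0)

theorem HasSymbol.approxEigen_of_diagOp {T : L2 →L[ℂ] L2} {f ψ : C(Torus, ℂ)} {u : ℝ → L2}
    {θ : Torus} {c : ℂ} (hT : HasSymbol T f ψ) (hu : ConcentratesAt u θ)
    (h : ApproxEigen (diagOp f ψ) u c) : ApproxEigen T u c := by
  have h1 := hu.tendsto_of_isCompactOperator (isCompactOperator_of_mem_finiteRankClosure hT)
  have h2 := h1.add h
  rw [add_zero] at h2
  refine h2.congr fun r => ?_
  rw [sub_apply]; abel

theorem HasSymbol.approxEigen_kernel {T : L2 →L[ℂ] L2} {f ψ : C(Torus, ℂ)}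
    (hT : HasSymbol T f ψ) (θ : Torus) : ApproxEigen T (fun r => kernel (r * pt θ)) (f θ) := by
  have hu := concentratesAt_kernel θ
  refine hT.approxEigen_of_diagOp hu ?_
  have h := (Pplus.continuous.tendsto 0).comp (hu.tendsto_mul f)
  rw [map_zero] at h
  refine h.congr' ?_
  filter_upwards [eventually_radial] with r hr
  have e := Pplus_kernel (norm_radial_mul_pt_lt_one hr θ)
  rw [Function.comp_apply, map_sub, map_smul, diagOp_apply, Pminus_apply (kernel _), e, sub_self,
    map_zero, map_zero, add_zero]

theorem HasSymbol.approxEigen_coKernel {T : L2 →L[ℂ] L2} {f ψ : C(Torus, ℂ)}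
    (hT : HasSymbol T f ψ) (θ : Torus) : ApproxEigen T (fun r => coKernel (r * pt θ)) (ψ θ) := by
  have hu := concentratesAt_coKernel θ
  refine hT.approxEigen_of_diagOp hu ?_
  have h := (Pminus.continuous.tendsto 0).comp (hu.tendsto_mul ψ)
  rw [map_zero] at h
  refine h.congr' ?_
  filter_upwards [eventually_radial] with r hr
  have e := Pplus_coKernel (norm_radial_mul_pt_lt_one hr θ)
  have e' : Pminus (coKernel (r * pt θ)) = coKernel (r * pt θ) := by
    rw [Pminus_apply, e, sub_zero]
  rw [Function.comp_apply, map_sub, map_smul, diagOp_apply, e, e', map_zero, map_zero, zero_add]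

theorem ApproxEigen.tendsto_inner {T : L2 →L[ℂ] L2} {u : ℝ → L2} {c : ℂ}
    (h : ApproxEigen T u c) (h1 : ∀ᶠ r in radial, ‖u r‖ = 1) :
    Tendsto (fun r => (inner ℂ (u r) (T (u r)) : ℂ)) radial (𝓝 c) := by
  have h2 : Tendsto (fun r => (inner ℂ (u r) (T (u r) - c • u r) : ℂ)) radial (𝓝 0) := by
    refine squeeze_zero_norm' ?_ (tendsto_zero_iff_norm_tendsto_zero.mp h)
    filter_upwards [h1] with r hr
    simpa [hr] using norm_inner_le_norm (𝕜 := ℂ) (u r) (T (u r) - c • u r)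
  have h3 := h2.add_const c
  rw [zero_add] at h3
  refine h3.congr' ?_
  filter_upwards [h1] with r hr
  rw [inner_sub_right, inner_smul_right, inner_self_eq_norm_sq_to_K, hr]
  simp

theorem ApproxEigen.norm_le {T : L2 →L[ℂ] L2} {u : ℝ → L2} {c : ℂ}
    (h : ApproxEigen T u c) (h1 : ∀ᶠ r in radial, ‖u r‖ = 1) : ‖c‖ ≤ ‖T‖ := by
  refine le_of_tendsto (h.tendsto_inner h1).norm ?_
  filter_upwards [h1] with r hr
  have h2 := norm_inner_le_norm (𝕜 := ℂ) (u r) (T (u r))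
  have h3 := T.le_opNorm (u r)
  rw [hr, one_mul] at h2
  rw [hr, mul_one] at h3
  exact h2.trans h3

/-- Symbol values are approximate eigenvalues along unit vectors. Applied to differences, this makes
the symbols of a convergent sequence of operators Cauchy. -/
theorem HasSymbol.norm_le {T : L2 →L[ℂ] L2} {f ψ : C(Torus, ℂ)} (hT : HasSymbol T f ψ) :
    ‖f‖ ≤ ‖T‖ ∧ ‖ψ‖ ≤ ‖T‖ :=
  ⟨(ContinuousMap.norm_le _ (norm_nonneg _)).mpr fun θ =>
    (hT.approxEigen_kernel θ).norm_le (concentratesAt_kernel θ).norm_eq_one,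
  (ContinuousMap.norm_le _ (norm_nonneg _)).mpr fun θ =>
    (hT.approxEigen_coKernel θ).norm_le (concentratesAt_coKernel θ).norm_eq_one⟩

theorem isClosed_exists_hasSymbol : IsClosed {T : L2 →L[ℂ] L2 | ∃ f ψ, HasSymbol T f ψ} := by
  refine isClosed_of_closure_subset fun T hT => ?_
  obtain ⟨S, hS, hST⟩ := mem_closure_iff_seq_limit.mp hT
  choose f ψ hfψ using hS
  have hc : ∀ {g : ℕ → C(Torus, ℂ)}, (∀ m n, ‖g m - g n‖ ≤ ‖S m - S n‖) → CauchySeq g := by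
    intro g hg
    rw [Metric.cauchySeq_iff]
    intro ε hε
    obtain ⟨N, hN⟩ := Metric.cauchySeq_iff.mp hST.cauchySeq ε hε
    refine ⟨N, fun m hm n hn => ?_⟩
    have := hN m hm n hn
    rw [dist_eq_norm] at this ⊢
    exact (hg m n).trans_lt this
  obtain ⟨F, hF⟩ := cauchySeq_tendsto_of_complete
    (hc fun m n => ((hfψ m).sub (hfψ n)).norm_le.1)
  obtain ⟨Ψ, hΨ⟩ := cauchySeq_tendsto_of_complete
    (hc fun m n => ((hfψ m).sub (hfψ n)).norm_le.2)
  refine ⟨F, Ψ, ?_⟩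
  have hD := (continuous_diagOp.tendsto (F, Ψ)).comp (hF.prodMk_nhds hΨ)
  exact (Submodule.isClosed_topologicalClosure _).mem_of_tendsto (hST.sub hD)
    (Eventually.of_forall hfψ)

theorem exists_hasSymbol_of_mem {T : L2 →L[ℂ] L2} (hT : T ∈ gsioAlgebraC) :
    ∃ f ψ, HasSymbol T f ψ := by
  refine closure_minimal ?_ isClosed_exists_hasSymbol hT
  rintro _ ⟨n, m, H, hH, rfl⟩
  refine exists_hasSymbol_sum _ fun i => exists_hasSymbol_prod fun A hA => ?_
  obtain ⟨j, rfl⟩ := List.mem_ofFn.mp hA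
  exact exists_hasSymbol_gsio (hH i j)

theorem HasSymbol.hasBoundarySymbols {T : L2 →L[ℂ] L2} {f ψ : C(Torus, ℂ)}
    (hT : HasSymbol T f ψ) : HasBoundarySymbols T f ψ := fun θ =>
  ⟨(hT.approxEigen_kernel θ).tendsto_inner (concentratesAt_kernel θ).norm_eq_one,
    (hT.approxEigen_coKernel θ).tendsto_inner (concentratesAt_coKernel θ).norm_eq_one⟩

/-! ### Fredholm operators: invertible symbols and regularizers -/

theorem exists_compact_parametrix {T : L2 →L[ℂ] L2} (hT : T.IsFredholm) :
    ∃ S : L2 →L[ℂ] L2, IsCompactOperator (S * T - 1 : L2 →L[ℂ] L2) := by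
  obtain ⟨S, hS, -⟩ := hT.exists_isQuasiInverse
  refine ⟨S, isCompactOperator_of_mem_finiteRankClosure (mem_finiteRankClosure_of_range ?_)⟩
  exact hasFiniteRange_iff.mp (LinearMap.FiniteRangeSetoid.equiv_iff_hasFiniteRange.mp hS)

/-- If `c = 0` then `T u → 0`. With `S T = 1 + K` and `K` compact, `u = S T u - K u` would tend to
zero, contradicting `‖u‖ = 1`. -/
theorem ApproxEigen.ne_zero {T : L2 →L[ℂ] L2} {u : ℝ → L2} {θ : Torus} {c : ℂ}
    (h : ApproxEigen T u c) (hu : ConcentratesAt u θ) (hT : T.IsFredholm) : c ≠ 0 := by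
  rintro rfl
  obtain ⟨S, hS⟩ := exists_compact_parametrix hT
  have h1 : Tendsto (fun r => T (u r)) radial (𝓝 0) := by simpa [ApproxEigen] using h
  have h2 := (S.continuous.tendsto 0).comp h1
  rw [map_zero] at h2
  have h3 := h2.sub (hu.tendsto_of_isCompactOperator hS)
  rw [sub_zero] at h3
  have h4 : Tendsto u radial (𝓝 0) := by
    refine h3.congr fun r => ?_
    exact sub_sub_cancel (S (T (u r))) (u r)
  have h5 := h4.norm.congr' hu.norm_eq_one
  rw [norm_zero] at h5
  exact one_ne_zero (tendsto_nhds_unique tendsto_const_nhds h5)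

theorem isUnit_of_forall_ne_zero {f : C(Torus, ℂ)} (hf : ∀ θ, f θ ≠ 0) :
    ∃ g : C(Torus, ℂ)ˣ, (g : C(Torus, ℂ)) = f :=
  (ContinuousMap.isUnit_iff_forall_ne_zero f).mpr hf

theorem HasSymbol.exists_units {T : L2 →L[ℂ] L2} {f ψ : C(Torus, ℂ)} (hT : HasSymbol T f ψ)
    (hF : T.IsFredholm) :
    (∃ g : C(Torus, ℂ)ˣ, (g : C(Torus, ℂ)) = f) ∧ ∃ χ : C(Torus, ℂ)ˣ, (χ : C(Torus, ℂ)) = ψ :=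
  ⟨isUnit_of_forall_ne_zero fun θ =>
    (hT.approxEigen_kernel θ).ne_zero (concentratesAt_kernel θ) hF,
  isUnit_of_forall_ne_zero fun θ =>
    (hT.approxEigen_coKernel θ).ne_zero (concentratesAt_coKernel θ) hF⟩

theorem HasSymbol.mul_sub_one_mem {S T : L2 →L[ℂ] L2} {f ψ f' ψ' : C(Torus, ℂ)}
    (hS : HasSymbol S f ψ) (hT : HasSymbol T f' ψ') (h1 : f * f' = 1) (h2 : ψ * ψ' = 1) :
    S * T - 1 ∈ finiteRankClosure L2 := by
  have h := hS.mul hT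
  rw [h1, h2] at h
  exact h.sub_mem hasSymbol_one

theorem HasSymbol.isRegularizer {T : L2 →L[ℂ] L2} {f ψ : C(Torus, ℂ)ˣ}
    (hT : HasSymbol T f ψ) : IsRegularizer
      (gsioC !![((f⁻¹ : C(Torus, ℂ)ˣ) : C(Torus, ℂ)), 0;
        0, ((ψ⁻¹ : C(Torus, ℂ)ˣ) : C(Torus, ℂ))]) T := by
  have hB := hasSymbol_gsioC ((f⁻¹ : C(Torus, ℂ)ˣ) : C(Torus, ℂ)) 0 0
    ((ψ⁻¹ : C(Torus, ℂ)ˣ) : C(Torus, ℂ))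
  exact ⟨isCompactOperator_of_mem_finiteRankClosure
      (hB.mul_sub_one_mem hT f.inv_mul ψ.inv_mul),
    isCompactOperator_of_mem_finiteRankClosure
      (hT.mul_sub_one_mem hB f.mul_inv ψ.mul_inv)⟩

/-- The diagonal operator with the inverse symbol is a parametrix of `S`, and `T - S` is negligible.
-/
theorem HasSymbol.hasIndex_congr {S T : L2 →L[ℂ] L2} {f ψ : C(Torus, ℂ)ˣ} {n : ℤ}
    (hS : HasSymbol S f ψ) (hT : HasSymbol T f ψ) (hn : HasIndex S n) : HasIndex T n :=
  have hB := hasSymbol_diagOp ((f⁻¹ : C(Torus, ℂ)ˣ) : C(Torus, ℂ))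
    ((ψ⁻¹ : C(Torus, ℂ)ˣ) : C(Torus, ℂ))
  hn.congr (hB.mul_sub_one_mem hS f.inv_mul ψ.inv_mul)
    (hS.mul_sub_one_mem hB f.mul_inv ψ.mul_inv) (hT.sub_mem hS)

theorem exists_hasIndex_diagOp (f ψ : C(Torus, ℂ)ˣ) : ∃ n, HasIndex (diagOp f ψ) n :=
  have hA := hasSymbol_diagOp (f : C(Torus, ℂ)) (ψ : C(Torus, ℂ))
  have hB := hasSymbol_diagOp ((f⁻¹ : C(Torus, ℂ)ˣ) : C(Torus, ℂ))
    ((ψ⁻¹ : C(Torus, ℂ)ˣ) : C(Torus, ℂ))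
  exists_hasIndex (hB.mul_sub_one_mem hA f.inv_mul ψ.inv_mul)
    (hA.mul_sub_one_mem hB f.mul_inv ψ.mul_inv)

/-! ### The index as a homomorphism on invertible functions -/

/-- The index of the Toeplitz-type operator `P₊ f P₊ + P₋`. -/
def toeplitzIndex (f : C(Torus, ℂ)ˣ) : ℤ := (exists_hasIndex_diagOp f 1).choose

theorem hasIndex_toeplitzIndex (f : C(Torus, ℂ)ˣ) :
    HasIndex (diagOp f 1) (toeplitzIndex f) := (exists_hasIndex_diagOp f 1).choose_spec

theorem toeplitzIndex_eq {f : C(Torus, ℂ)ˣ} {n : ℤ} (h : HasIndex (diagOp f 1) n) :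
    toeplitzIndex f = n := (hasIndex_toeplitzIndex f).unique h

theorem toeplitzIndex_mul (f g : C(Torus, ℂ)ˣ) :
    toeplitzIndex (f * g) = toeplitzIndex f + toeplitzIndex g := by
  refine toeplitzIndex_eq ?_
  have h := (hasSymbol_diagOp (f : C(Torus, ℂ)) 1).mul (hasSymbol_diagOp (g : C(Torus, ℂ)) 1)
  rw [mul_one] at h
  exact HasSymbol.hasIndex_congr (f := f * g) (ψ := 1) h (hasSymbol_diagOp _ _)
    ((hasIndex_toeplitzIndex f).mul (hasIndex_toeplitzIndex g))

/-- `toeplitzIndex` as a group homomorphism. -/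
def toeplitzIndexHom : C(Torus, ℂ)ˣ →* Multiplicative ℤ :=
  MonoidHom.mk' (fun f => Multiplicative.ofAdd (toeplitzIndex f)) fun f g => by
    rw [toeplitzIndex_mul, ofAdd_add]

theorem toeplitzIndex_zpow (f : C(Torus, ℂ)ˣ) (n : ℤ) :
    toeplitzIndex (f ^ n) = n * toeplitzIndex f := by
  have h := map_zpow toeplitzIndexHom f n
  have h2 := congrArg Multiplicative.toAdd h
  rw [toAdd_zpow, smul_eq_mul] at h2
  exact h2

/-- The symbol factors as `(f, ψ) = (f ψ⁻¹, 1) (ψ, ψ)`. The second factor is realized by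
multiplication by `ψ`, which is invertible and so has index zero. -/
theorem HasSymbol.hasIndex {T : L2 →L[ℂ] L2} {f ψ : C(Torus, ℂ)ˣ} (hT : HasSymbol T f ψ) :
    HasIndex T (toeplitzIndex (f * ψ⁻¹)) := by
  have hM : HasSymbol (mulCLM (ψ : C(Torus, ℂ))) ψ ψ := mulCLM_sub_diagOp_mem _
  have hu : IsUnit (mulCLM (ψ : C(Torus, ℂ))) := by
    refine isUnit_iff_exists.mpr ⟨mulCLM ((ψ⁻¹ : C(Torus, ℂ)ˣ) : C(Torus, ℂ)), ?_, ?_⟩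
    · rw [← mulCLM_mul, ψ.mul_inv, mulCLM_one]
    · rw [← mulCLM_mul, ψ.inv_mul, mulCLM_one]
  have h := (hasSymbol_diagOp ((f * ψ⁻¹ : C(Torus, ℂ)ˣ) : C(Torus, ℂ)) 1).mul hM
  rw [one_mul, ← Units.val_mul, inv_mul_cancel_right] at h
  have hi := (hasIndex_toeplitzIndex (f * ψ⁻¹)).mul (hasIndex_of_isUnit hu)
  rw [add_zero] at hi
  exact h.hasIndex_congr hT hi

/-- The exponential of a continuous function, as a unit. -/
def expUnit (a : C(Torus, ℂ)) : C(Torus, ℂ)ˣ where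
  val := ⟨fun θ => Complex.exp (a θ), by fun_prop⟩
  inv := ⟨fun θ => Complex.exp (-a θ), by fun_prop⟩
  val_inv := by ext θ; simp [← Complex.exp_add]
  inv_val := by ext θ; simp [← Complex.exp_add]

theorem expUnit_apply (a : C(Torus, ℂ)) (θ : Torus) :
    (expUnit a : C(Torus, ℂ)) θ = Complex.exp (a θ) := rfl

theorem tendsto_expUnit_div (a : C(Torus, ℂ)) :
    Tendsto (fun N : ℕ => (expUnit ((N : ℂ)⁻¹ • a) : C(Torus, ℂ))) atTop (𝓝 1) := by
  have h : Continuous fun b : C(Torus, ℂ) => (expUnit b : C(Torus, ℂ)) :=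
    ContinuousMap.continuous_postcomp (⟨Complex.exp, Complex.continuous_exp⟩ : C(ℂ, ℂ))
  have h2 : Tendsto (fun N : ℕ => (N : ℂ)⁻¹ • a) atTop (𝓝 0) := by
    have := (tendsto_inv_atTop_nhds_zero_nat (𝕜 := ℂ)).smul_const a
    rwa [zero_smul] at this
  have h3 : (expUnit 0 : C(Torus, ℂ)) = 1 := by ext θ; simp [expUnit_apply]
  rw [← h3]
  exact (h.tendsto 0).comp h2

/-- For large `N` the operator with symbol `exp (a / N)` is near the identity, hence invertible of
index zero, and `exp a` is the `N`-th power of that symbol. -/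
theorem toeplitzIndex_expUnit (a : C(Torus, ℂ)) : toeplitzIndex (expUnit a) = 0 := by
  have h1 : Tendsto (fun N : ℕ => diagOp (expUnit ((N : ℂ)⁻¹ • a) : C(Torus, ℂ)) 1)
      atTop (𝓝 1) := by
    have := (continuous_diagOp.tendsto (1, 1)).comp
      ((tendsto_expUnit_div a).prodMk_nhds (tendsto_const_nhds (x := (1 : C(Torus, ℂ)))))
    rw [diagOp_one_one] at this
    exact this
  obtain ⟨N, hN, hpos⟩ := ((h1.eventually (Units.nhds (1 : (L2 →L[ℂ] L2)ˣ))).and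
    (eventually_gt_atTop 0)).exists
  have h0 : toeplitzIndex (expUnit ((N : ℂ)⁻¹ • a)) = 0 :=
    toeplitzIndex_eq (hasIndex_of_isUnit hN)
  have hp : expUnit a = expUnit ((N : ℂ)⁻¹ • a) ^ (N : ℤ) := by
    ext θ
    rw [zpow_natCast, Units.val_pow_eq_pow_val, ContinuousMap.pow_apply, expUnit_apply,
      expUnit_apply, ← Complex.exp_nat_mul, ContinuousMap.smul_apply, smul_eq_mul,
      mul_inv_cancel_left₀ (Nat.cast_ne_zero.mpr hpos.ne')]
  rw [hp, toeplitzIndex_zpow, h0, mul_zero]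

/-! ### The shift and the winding number -/

/-- The coordinate function `z` on the circle, as a unit. -/
def coordUnit : C(Torus, ℂ)ˣ where
  val := fourier 1
  inv := fourier (-1)
  val_inv := (mul_comm _ _).trans (fourier_neg_mul_fourier 1)
  inv_val := fourier_neg_mul_fourier 1

theorem diagOp_monomial_of_nonneg (m : ℤ) {n : ℤ} (hn : 0 ≤ n) :
    diagOp (fourier m) 1 (monomial n) = Pplus (monomial (m + n)) := by
  rw [diagOp_apply, Pminus_apply (monomial n), Pplus_monomial_of_nonneg hn, sub_self, map_zero,
    map_zero, add_zero, mulCLM_fourier_monomial]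

theorem diagOp_monomial_of_neg (m : ℤ) {n : ℤ} (hn : n < 0) :
    diagOp (fourier m) 1 (monomial n) = monomial n := by
  rw [diagOp_apply, Pminus_apply (monomial n), Pplus_monomial_of_neg hn, sub_zero, map_zero,
    map_zero, zero_add, mulCLM_one]
  exact (congrArg (monomial n - ·) (Pplus_monomial_of_neg hn)).trans (sub_zero _)

theorem diagOp_neg_one_mul_diagOp_one :
    diagOp (fourier (-1)) 1 * diagOp (fourier 1) 1 = 1 := by
  refine ext_monomial fun n => ?_
  rw [mul_apply_eq_comp]
  refine Eq.trans ?_ (show monomial n = (1 : L2 →L[ℂ] L2) (monomial n) from rfl)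
  rcases lt_or_ge n 0 with hn | hn
  · rw [diagOp_monomial_of_neg _ hn, diagOp_monomial_of_neg _ hn]
  · rw [diagOp_monomial_of_nonneg _ hn, Pplus_monomial_of_nonneg (by lia),
      diagOp_monomial_of_nonneg _ (by lia), neg_add_cancel_left, Pplus_monomial_of_nonneg hn]

/-- On `H²` this is shift times backward shift, which loses exactly the constant term; it identifies
the kernel of the backward shift. -/
theorem diagOp_one_mul_diagOp_neg_one :
    diagOp (fourier 1) 1 * diagOp (fourier (-1)) 1 =
      1 - (innerSL ℂ (monomial 0)).smulRight (monomial 0) := by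
  refine ext_monomial fun n => ?_
  rw [mul_apply_eq_comp]
  refine Eq.trans ?_ (show monomial n - (inner ℂ (monomial 0) (monomial n) : ℂ) • monomial 0 =
    (1 - (innerSL ℂ (monomial 0)).smulRight (monomial 0) : L2 →L[ℂ] L2) (monomial n) from rfl)
  rw [inner_monomial]
  rcases lt_trichotomy n 0 with hn | rfl | hn
  · rw [diagOp_monomial_of_neg _ hn, diagOp_monomial_of_neg _ hn, if_neg hn.ne', zero_smul,
      sub_zero]
  · rw [diagOp_monomial_of_nonneg _ le_rfl, Pplus_monomial_of_neg (by lia), map_zero, if_pos rfl,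
      one_smul, sub_self]
  · rw [diagOp_monomial_of_nonneg _ hn.le, Pplus_monomial_of_nonneg (by lia),
      diagOp_monomial_of_nonneg _ (by lia), add_neg_cancel_left, Pplus_monomial_of_nonneg hn.le,
      if_neg hn.ne, zero_smul, sub_zero]

theorem ker_diagOp_fourier_neg_one :
    (diagOp (fourier (-1)) 1 : L2 →ₗ[ℂ] L2).ker = Submodule.span ℂ {monomial 0} := by
  ext x
  rw [LinearMap.mem_ker, Submodule.mem_span_singleton]
  constructor
  · intro hx
    have h := congrArg (fun A : L2 →L[ℂ] L2 => A x) diagOp_one_mul_diagOp_neg_one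
    have h2 : (0 : L2) = x - (inner ℂ (monomial 0) x : ℂ) • monomial 0 := by
      refine Eq.trans ?_ h
      exact ((congrArg (diagOp (fourier 1) 1) hx).trans (map_zero _)).symm
    exact ⟨_, (sub_eq_zero.mp h2.symm).symm⟩
  · rintro ⟨c, rfl⟩
    rw [map_smul]
    have : diagOp (fourier (-1)) 1 (monomial 0) = 0 := by
      rw [diagOp_monomial_of_nonneg _ le_rfl, Pplus_monomial_of_neg (by lia)]
    exact (congrArg (c • ·) this).trans (smul_zero c)

theorem hasIndex_diagOp_fourier_neg_one : HasIndex (diagOp (fourier (-1)) 1) 1 := by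
  have hs : Function.Surjective (diagOp (fourier (-1)) 1 : L2 →ₗ[ℂ] L2) := fun x =>
    ⟨diagOp (fourier 1) 1 x, congrArg (fun A : L2 →L[ℂ] L2 => A x) diagOp_neg_one_mul_diagOp_one⟩
  have hne : monomial 0 ≠ 0 := fun h => by
    have := norm_monomial 0
    rw [h, norm_zero] at this
    exact zero_ne_one this
  refine ⟨by rw [ker_diagOp_fourier_neg_one]; infer_instance,
    by rw [LinearMap.range_eq_top.mpr hs]; infer_instance, ?_⟩
  rw [LinearMap.index_of_surjective hs, ker_diagOp_fourier_neg_one, finrank_span_singleton hne]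
  rfl

theorem toeplitzIndex_coordUnit : toeplitzIndex coordUnit = -1 := by
  have h : toeplitzIndex (coordUnit ^ (-1 : ℤ)) = 1 := by
    rw [zpow_neg_one]
    exact toeplitzIndex_eq hasIndex_diagOp_fourier_neg_one
  rw [toeplitzIndex_zpow] at h
  lia

theorem pt_coe (t : ℝ) : pt (t : Torus) = Complex.exp (t * Complex.I) := by
  rw [pt, AddCircle.toCircle_apply_mk, Circle.coe_exp]
  congr 2
  push_cast
  field_simp

theorem coordUnit_zpow_apply (n : ℤ) (t : ℝ) :
    ((coordUnit ^ n : C(Torus, ℂ)ˣ) : C(Torus, ℂ)) (t : Torus) =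
      Complex.exp (n * (t * Complex.I)) := by
  have h : ((coordUnit ^ n : C(Torus, ℂ)ˣ) : C(Torus, ℂ)) (t : Torus) = pt (t : Torus) ^ n := by
    let ev : C(Torus, ℂ) →* ℂ :=
      { toFun := fun f => f (t : Torus), map_one' := rfl, map_mul' := fun _ _ => rfl }
    have h1 := congrArg (Units.val) (map_zpow (Units.map ev) coordUnit n)
    rw [Units.val_zpow_eq_zpow_val] at h1
    refine h1.trans ?_
    congr 1
    exact fourier_one_apply _
  rw [h, pt_coe, ← Complex.exp_int_mul]

theorem exists_eq_coordUnit_zpow_mul_expUnit (f : C(Torus, ℂ)ˣ) :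
    ∃ a : C(Torus, ℂ), f = coordUnit ^ windingNumber f * expUnit a := by
  obtain ⟨g, hg⟩ := exists_isLogLift f
  set n := windingNumber f
  have hn : g (2 * π) - g 0 = 2 * π * Complex.I * n := windingNumber_spec f g hg
  -- Subtracting `i n t` cancels the increment `2 π i n` of the logarithm, so `b` descends to the
  -- circle.
  let b : ℝ → ℂ := fun t => g t - n * (t * Complex.I)
  have hb : b 0 = b (2 * π) := by
    simp only [b]
    push_cast
    linear_combination -hn
  have hbc : Continuous b := by fun_prop
  refine ⟨⟨AddCircle.liftIco (2 * π) 0 b,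
    AddCircle.liftIco_zero_continuous hb hbc.continuousOn⟩, ?_⟩
  ext θ
  obtain ⟨t, ht, rfl⟩ : ∃ t ∈ Set.Ico 0 (2 * π), (t : Torus) = θ := by
    have := AddCircle.coe_image_Ico_eq (2 * π) 0
    rw [zero_add] at this
    exact (Set.mem_image _ _ _).mp (this ▸ Set.mem_univ θ)
  have hl : AddCircle.liftIco (2 * π) 0 b (t : Torus) = b t :=
    AddCircle.liftIco_zero_coe_apply ht
  rw [Units.val_mul, ContinuousMap.mul_apply, coordUnit_zpow_apply, expUnit_apply]
  refine Eq.trans ?_ (congrArg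
    (fun z => Complex.exp (n * (t * Complex.I)) * Complex.exp z) hl.symm)
  rw [← Complex.exp_add, add_sub_cancel, hg]

theorem toeplitzIndex_eq_neg_windingNumber (f : C(Torus, ℂ)ˣ) :
    toeplitzIndex f = -windingNumber f := by
  obtain ⟨a, ha⟩ := exists_eq_coordUnit_zpow_mul_expUnit f
  nth_rewrite 1 [ha]
  rw [toeplitzIndex_mul, toeplitzIndex_zpow, toeplitzIndex_coordUnit, toeplitzIndex_expUnit]
  ring

theorem HasSymbol.index_eq {T : L2 →L[ℂ] L2} {f ψ : C(Torus, ℂ)ˣ} (hT : HasSymbol T f ψ)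
    (hF : T.IsFredholm) : index T = windingNumber ψ - windingNumber f := by
  -- Additivity on `(f ψ⁻¹) ψ = f` gives the index of `f ψ⁻¹` without computing the winding number
  -- of an inverse.
  have h1 := toeplitzIndex_mul (f * ψ⁻¹) ψ
  rw [inv_mul_cancel_right, toeplitzIndex_eq_neg_windingNumber f,
    toeplitzIndex_eq_neg_windingNumber ψ] at h1
  rw [index_eq_of_hasIndex hT.hasIndex hF.isClosed_range]
  lia

end GSIO

end

theorem mainTheorem4 :
    (∀ T ∈ GSIO.gsioAlgebraC, T.IsFredholm →
      ∃ f₀ ψ₀ : C(GSIO.Torus, ℂ)ˣ,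
        GSIO.HasBoundarySymbols T f₀ ψ₀ ∧
        GSIO.IsRegularizer
          (GSIO.gsioC !![((f₀⁻¹ : C(GSIO.Torus, ℂ)ˣ) : C(GSIO.Torus, ℂ)), 0;
            0, ((ψ₀⁻¹ : C(GSIO.Torus, ℂ)ˣ) : C(GSIO.Torus, ℂ))]) T ∧
        GSIO.index T = GSIO.windingNumber ψ₀ - GSIO.windingNumber f₀) ∧
    (∀ f g φ ψ : C(GSIO.Torus, ℂ), (GSIO.gsioC !![f, φ; g, ψ]).IsFredholm →
      ∃ f₁ ψ₁ : C(GSIO.Torus, ℂ)ˣ,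
        (f₁ : C(GSIO.Torus, ℂ)) = f ∧ (ψ₁ : C(GSIO.Torus, ℂ)) = ψ ∧
        GSIO.index (GSIO.gsioC !![f, φ; g, ψ]) =
          GSIO.windingNumber ψ₁ - GSIO.windingNumber f₁) := by
  refine ⟨fun T hT hF => ?_, fun f g φ ψ hF => ?_⟩
  · obtain ⟨f, ψ, h⟩ := GSIO.exists_hasSymbol_of_mem hT
    obtain ⟨⟨f₀, rfl⟩, ψ₀, rfl⟩ := h.exists_units hF
    exact ⟨f₀, ψ₀, h.hasBoundarySymbols, h.isRegularizer, h.index_eq hF⟩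
  · have h := GSIO.hasSymbol_gsioC f g φ ψ
    obtain ⟨⟨f₁, rfl⟩, ψ₁, rfl⟩ := h.exists_units hF
    exact ⟨f₁, ψ₁, rfl, rfl, h.index_eq hF⟩
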